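/- Let $\Bbbk$ be an algebraically closed field of characteristic zero and let $G$ be a finite group. Let $\mathcal D(G)$ be the Drinfeld double of $G$ over $\Bbbk$: the Hopf algebra with basis $e_g\# h$ ($g,h\in G$), multiplication $(e_g\# h)(e_{g'}\# h')=\delta_{g,\,hg'h^{-1}}\,e_g\# hh'$, unit $\varepsilon\#1$ where $\varepsilon=\sum_{g\in G}e_g$, comultiplication $\Delta(e_g\# h)=\sum_{ab=g}(e_b\# h)\otimes(e_a\# h)$ and counit $e_g\#h\mapsto\delta_{g,1}$. Let $\operatorname{Aut}(\mathcal D(G))$ be its group of Hopf algebra automorphisms under composition. Let $\Lambda_c(G)\le\operatorname{Aut}(\mathcal D(G))$ be the subgroup of those $\psi$ whose components $r(g)=(\mathrm{id}\otimes\varepsilon)(\psi(\varepsilon\# g))\in\Bbbk^G$ and $v(g)=(\mathrm{ev}_1\otimes\mathrm{id})(\psi(\varepsilon\# g))\in\Bbbk G$ satisfy $r(g)=\varepsilon$ and $v(g)=g$ for all $g\in G$; equivalently, $\psi(\varepsilon\# g)=\varepsilon\# g$ for all $g\in G$. Let $\operatorname{BCh}(G)=\operatorname{Hom}(G,\widehat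 G)$, where $\widehat G=\operatorname{Hom}(G,\Bbbk^\times)$, be the group of bicharacters $G\times G\to\Bbbk^\times$, on which $\operatorname{Aut}(G)$ acts (from the right) by $r^v(h)(g)=r(v(h))(v(g))$. The semidirect product $\operatorname{BCh}(G)\rtimes\operatorname{Aut}(G)$ is regarded as a subgroup of $\operatorname{Aut}(\mathcal D(G))$ by letting $r\in\operatorname{BCh}(G)$ act as $e_g\# h\mapsto r(h)(g)\,e_g\# h$ and $v\in\operatorname{Aut}(G)$ act as $e_g\# h\mapsto e_{v(g)}\# v(h)$. The group $G$ is called a stem group if $Z(G)\le G'$. **Theorem.** $\Lambda_c(G)$ is normal in $\operatorname{Aut}(\mathcal D(G))$ if and only if $G$ is a stem group. Moreover $\operatorname{Aut}(\mathcal D(G))\cong\Lambda_c(G)\rtimes(\operatorname{BCh}(G)\rtimes\operatorname{Aut}(G))$, as the semidirect product of these two subgroups (that is, for some action of the second on the first there is an isomorphism from the semidirect product onto $\operatorname{Aut}(\mathcal D(G))$ that restricts to the inclusion on each factor), if and only if $G$ is a stem group. -/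

import Mathlib

open scoped TensorProduct

/-! ### The Drinfeld double of a finite group -/

/-- The underlying space of the Drinfeld double `D(G)`, with basis the simple tensors
`e_g # h` of `k^G ⊗ kG`, indexed by the pairs `(g, h)`. -/
def DrinfeldDouble (k G : Type*) [Zero k] : Type _ := G × G →₀ k

namespace DrinfeldDouble

section Basic

variable {k G : Type*} [Field k]

noncomputable instance : AddCommGroup (DrinfeldDouble k G) :=
  inferInstanceAs (AddCommGroup (G × G →₀ k))

noncomputable instance : Module k (DrinfeldDouble k G) :=
  inferInstanceAs (Module k (G × G →₀ k))

variable (k) in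
/-- The basis element `e_g # h`. -/
noncomputable def e (g h : G) : DrinfeldDouble k G := Finsupp.single (g, h) (1 : k)

/-- The linear map with prescribed values on the basis elements `e_g # h`. -/
noncomputable def lift {M : Type*} [AddCommMonoid M] [Module k M] (f : G → G → M) :
    DrinfeldDouble k G →ₗ[k] M :=
  Finsupp.linearCombination k (fun x : G × G => f x.1 x.2)

@[simp] theorem lift_e {M : Type*} [AddCommMonoid M] [Module k M] (f : G → G → M) (g h : G) :
    lift f (e k g h) = f g h := by
  unfold lift e
  exact (Finsupp.linearCombination_single k _ _).trans (one_smul _ _)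

theorem induction_e {P : DrinfeldDouble k G → Prop} (x : DrinfeldDouble k G) (h0 : P 0)
    (hadd : ∀ x y, P x → P y → P (x + y)) (hsmul : ∀ (c : k) (x), P x → P (c • x))
    (he : ∀ g h, P (e k g h)) : P x := by
  refine Finsupp.induction_linear (motive := P) x h0 (fun x y hx hy => hadd x y hx hy) ?_
  rintro ⟨g, h⟩ c
  have : (Finsupp.single (g, h) c : G × G →₀ k) = c • Finsupp.single (g, h) (1 : k) := by simp
  rw [this]
  exact hsmul c _ (he g h)

theorem hom_ext {M : Type*} [AddCommMonoid M] [Module k M] {f f' : DrinfeldDouble k G →ₗ[k] M}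
    (h : ∀ a b, f (e k a b) = f' (e k a b)) : f = f' := by
  ext x
  induction x using induction_e with
  | h0 => simp
  | hadd x y hx hy => simp [hx, hy]
  | hsmul c x hx => simp [hx]
  | he a b => exact h a b

end Basic

section Structure

set_option linter.unusedSectionVars false

variable {k G : Type*} [Field k] [Group G] [Fintype G] [DecidableEq G]

/-! #### The algebra structure: `(e_g # h)(e_g' # h') = δ_{g, h g' h⁻¹} e_g # h h'` -/

/-- The multiplication of `D(G)` as a bilinear map. -/
noncomputable def mulMap :
    DrinfeldDouble k G →ₗ[k] DrinfeldDouble k G →ₗ[k] DrinfeldDouble k G :=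
  lift fun g h => lift fun g' h' => if g = h * g' * h⁻¹ then e k g (h * h') else 0

/-- The group-like element `ε # h`, where `ε = ∑ g, e_g` is the identity of `k^G`. -/
noncomputable def ofGroup (k : Type*) {G : Type*} [Field k] [Fintype G] (h : G) :
    DrinfeldDouble k G := ∑ g : G, e k g h

noncomputable instance : Mul (DrinfeldDouble k G) := ⟨fun x y => mulMap x y⟩

noncomputable instance : One (DrinfeldDouble k G) := ⟨ofGroup k 1⟩

theorem mul_def (x y : DrinfeldDouble k G) : x * y = mulMap x y := rfl

theorem one_def : (1 : DrinfeldDouble k G) = ∑ g : G, e k g 1 := rfl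

theorem e_mul_e (g h g' h' : G) :
    e k g h * e k g' h' = if g = h * g' * h⁻¹ then e k g (h * h') else 0 := by
  simp [mul_def, mulMap]

theorem mul_add' (x y z : DrinfeldDouble k G) : x * (y + z) = x * y + x * z := by
  simp [mul_def]

theorem add_mul' (x y z : DrinfeldDouble k G) : (x + y) * z = x * z + y * z := by
  simp [mul_def]

theorem smul_mul' (c : k) (x y : DrinfeldDouble k G) : (c • x) * y = c • (x * y) := by
  simp [mul_def]

theorem mul_smul' (c : k) (x y : DrinfeldDouble k G) : x * (c • y) = c • (x * y) := by
  simp [mul_def]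

theorem zero_mul' (x : DrinfeldDouble k G) : 0 * x = 0 := by
  simp [mul_def]

theorem mul_zero' (x : DrinfeldDouble k G) : x * 0 = 0 := by
  simp [mul_def]

theorem mul_assoc' (x y z : DrinfeldDouble k G) : x * y * z = x * (y * z) := by
  induction x using induction_e with
  | h0 => simp [zero_mul']
  | hadd x x' hx hx' => simp [add_mul', hx, hx']
  | hsmul c x hx => simp [smul_mul', hx]
  | he a b =>
  induction y using induction_e with
  | h0 => simp [zero_mul', mul_zero']
  | hadd x x' hx hx' => simp [add_mul', mul_add', hx, hx']
  | hsmul c x hx => simp [smul_mul', mul_smul', hx]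
  | he a' b' =>
  induction z using induction_e with
  | h0 => simp [mul_zero']
  | hadd x x' hx hx' => simp [mul_add', hx, hx']
  | hsmul c x hx => simp [mul_smul', hx]
  | he a'' b'' =>
    rw [e_mul_e, e_mul_e]
    by_cases h1 : a = b * a' * b⁻¹ <;> by_cases h2 : a' = b' * a'' * b'⁻¹
    · subst h2; subst h1
      simp [e_mul_e, mul_assoc]
    · have : ¬ (a = b * b' * a'' * (b * b')⁻¹) := by
        intro h3; apply h2
        rw [h1] at h3
        have := congrArg (fun t => b⁻¹ * t * b) h3
        simpa [mul_assoc] using this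
      simp only [h1, h2, if_true, if_false, e_mul_e, mul_zero']
      rw [if_neg (by rwa [← h1])]
    · simp only [h1, if_false, zero_mul']
      rw [if_pos h2, e_mul_e, if_neg h1]
    · simp only [h1, h2, if_false, zero_mul', mul_zero']

theorem one_mul' (x : DrinfeldDouble k G) : 1 * x = x := by
  induction x using induction_e with
  | h0 => simp [mul_zero']
  | hadd x x' hx hx' => simp [mul_add', hx, hx']
  | hsmul c x hx => simp [mul_smul', hx]
  | he a b =>
    rw [one_def, mul_def, map_sum, LinearMap.sum_apply]
    simp_rw [← mul_def, e_mul_e]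
    simp

theorem mul_one' (x : DrinfeldDouble k G) : x * 1 = x := by
  induction x using induction_e with
  | h0 => simp [zero_mul']
  | hadd x x' hx hx' => simp [add_mul', hx, hx']
  | hsmul c x hx => simp [smul_mul', hx]
  | he a b =>
    rw [one_def, mul_def, map_sum]
    simp_rw [← mul_def, e_mul_e]
    rw [Finset.sum_eq_single (b⁻¹ * a * b)]
    · simp [mul_assoc]
    · intro c _ hc
      rw [if_neg]
      rintro rfl
      apply hc
      simp [mul_assoc]
    · simp

noncomputable instance : Ring (DrinfeldDouble k G) :=
  { (inferInstance : AddCommGroup (DrinfeldDouble k G)),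
    (inferInstance : Mul (DrinfeldDouble k G)),
    (inferInstance : One (DrinfeldDouble k G)) with
    left_distrib := mul_add'
    right_distrib := add_mul'
    zero_mul := zero_mul'
    mul_zero := mul_zero'
    mul_assoc := mul_assoc'
    one_mul := one_mul'
    mul_one := mul_one' }

noncomputable instance : Algebra k (DrinfeldDouble k G) :=
  Algebra.ofModule smul_mul' (fun c x y => mul_smul' c x y)

/-! #### The coalgebra structure of `(k^G)^cop ⊗ kG`:
`Δ(e_g # h) = ∑_{ab = g} (e_b # h) ⊗ (e_a # h)` and `ε(e_g # h) = δ_{g,1}` -/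

noncomputable instance : CoalgebraStruct k (DrinfeldDouble k G) where
  comul := lift fun g h => ∑ a : G, e k (a⁻¹ * g) h ⊗ₜ[k] e k a h
  counit := lift fun g _ => if g = 1 then 1 else 0

theorem comul_e (g h : G) :
    Coalgebra.comul (R := k) (e k g h) = ∑ a : G, e k (a⁻¹ * g) h ⊗ₜ[k] e k a h :=
  lift_e _ _ _

theorem counit_e (g h : G) :
    Coalgebra.counit (R := k) (e k g h) = if g = 1 then 1 else 0 :=
  lift_e _ _ _

noncomputable instance : Coalgebra k (DrinfeldDouble k G) where
  coassoc := by
    apply hom_ext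
    intro g h
    simp only [LinearMap.comp_apply, comul_e, map_sum, LinearMap.rTensor_tmul,
      LinearMap.lTensor_tmul, TensorProduct.sum_tmul, TensorProduct.tmul_sum,
      LinearEquiv.coe_coe, TensorProduct.assoc_tmul]
    conv_rhs => rw [Finset.sum_comm]
    refine Finset.sum_congr rfl fun t _ => ?_
    refine Fintype.sum_equiv (Equiv.mulLeft t) _ _ fun c => ?_
    simp [mul_assoc]
  rTensor_counit_comp_comul := by
    apply hom_ext
    intro g h
    simp only [LinearMap.comp_apply, comul_e, map_sum, LinearMap.rTensor_tmul, counit_e]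
    rw [Finset.sum_eq_single g]
    · simp
    · intro a _ ha
      rw [if_neg, TensorProduct.zero_tmul]
      intro h1; apply ha
      exact inv_mul_eq_one.mp h1
    · simp
  lTensor_counit_comp_comul := by
    apply hom_ext
    intro g h
    simp only [LinearMap.comp_apply, comul_e, map_sum, LinearMap.lTensor_tmul, counit_e]
    rw [Finset.sum_eq_single 1]
    · simp
    · intro a _ ha
      rw [if_neg ha, TensorProduct.tmul_zero]
    · simp

noncomputable instance : Bialgebra k (DrinfeldDouble k G) :=
  Bialgebra.mk' k (DrinfeldDouble k G)
    (by simp [one_def, counit_e])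
    (by
      intro x y
      have : (LinearMap.mul k (DrinfeldDouble k G)).compr₂ Coalgebra.counit =
          (LinearMap.mul k k).compl₁₂ Coalgebra.counit Coalgebra.counit := by
        apply hom_ext; intro g h; apply hom_ext; intro g' h'
        simp only [LinearMap.compr₂_apply, LinearMap.mul_apply', LinearMap.compl₁₂_apply,
          e_mul_e, counit_e]
        by_cases h1 : g = h * g' * h⁻¹
        · subst h1; simp [counit_e]
        · rw [if_neg h1]
          by_cases h2 : g' = 1
          · subst h2
            have : g ≠ 1 := by simpa using h1
            simp [this]
          · simp [h2]
      exact DFunLike.congr_fun (DFunLike.congr_fun this x) y)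
    (by
      simp only [one_def, map_sum, comul_e, Algebra.TensorProduct.one_def,
        TensorProduct.sum_tmul, TensorProduct.tmul_sum]
      rw [Finset.sum_comm]
      refine Finset.sum_congr rfl fun a _ => ?_
      exact Fintype.sum_equiv (Equiv.mulLeft a⁻¹) _ _ (fun b => rfl))
    (by
      intro x y
      have : (LinearMap.mul k (DrinfeldDouble k G)).compr₂ Coalgebra.comul =
          (LinearMap.mul k (DrinfeldDouble k G ⊗[k] DrinfeldDouble k G)).compl₁₂
            Coalgebra.comul Coalgebra.comul := by
        apply hom_ext; intro g h; apply hom_ext; intro g' h'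
        simp only [LinearMap.compr₂_apply, LinearMap.mul_apply', LinearMap.compl₁₂_apply,
          e_mul_e, comul_e, Finset.sum_mul, Finset.mul_sum,
          Algebra.TensorProduct.tmul_mul_tmul]
        have key : ∀ a : G, (∑ b : G, (if a⁻¹ * g = h * (b⁻¹ * g') * h⁻¹ then
              e k (a⁻¹ * g) (h * h') else 0) ⊗ₜ[k]
              (if a = h * b * h⁻¹ then e k a (h * h') else 0)) =
            if g = h * g' * h⁻¹ then e k (a⁻¹ * g) (h * h') ⊗ₜ[k] e k a (h * h') else 0 := by
          intro a
          rw [Finset.sum_eq_single (h⁻¹ * a * h)]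
          · have h2 : a = h * (h⁻¹ * a * h) * h⁻¹ := by group
            rw [if_pos h2]
            have h3 : (a⁻¹ * g = h * ((h⁻¹ * a * h)⁻¹ * g') * h⁻¹) ↔ g = h * g' * h⁻¹ := by
              have : h * ((h⁻¹ * a * h)⁻¹ * g') * h⁻¹ = a⁻¹ * (h * g' * h⁻¹) := by group
              rw [this, mul_right_inj]
            simp only [h3]
            split_ifs <;> simp
          · intro b _ hb
            rw [if_neg (c := a = h * b * h⁻¹), TensorProduct.tmul_zero]
            rintro rfl
            apply hb
            group
          · simp
        trans ∑ a : G, if g = h * g' * h⁻¹ then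
            e k (a⁻¹ * g) (h * h') ⊗ₜ[k] e k a (h * h') else 0
        · split_ifs with h1
          · simp [comul_e]
          · simp
        · first
          | exact (Finset.sum_congr rfl fun a _ => (key a)).symm
          | (rw [Finset.sum_comm]; exact (Finset.sum_congr rfl fun a _ => (key a)).symm)
      exact DFunLike.congr_fun (DFunLike.congr_fun this x) y)

/-- The antipode is `S(e_g # h) = e_{h⁻¹ g⁻¹ h} # h⁻¹`. -/
noncomputable instance : HopfAlgebra k (DrinfeldDouble k G) where
  antipode := lift fun g h => e k (h⁻¹ * g⁻¹ * h) h⁻¹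
  mul_antipode_rTensor_comul := by
    apply hom_ext
    intro g h
    simp only [LinearMap.comp_apply, comul_e, counit_e, map_sum, LinearMap.rTensor_tmul, lift_e,
      LinearMap.mul'_apply, e_mul_e, Algebra.linearMap_apply]
    rw [Algebra.algebraMap_eq_smul_one, one_def]
    have key : ∀ a : G, (h⁻¹ * (a⁻¹ * g)⁻¹ * h = h⁻¹ * a * h⁻¹⁻¹) ↔ g = 1 := by
      intro a
      simp [mul_assoc]
    simp only [key]
    by_cases hg : g = 1
    · subst hg
      simp only [if_true, one_smul]
      exact Fintype.sum_equiv (MulAut.conj h⁻¹).toEquiv _ _ fun a => by simp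
    · simp [hg]
  mul_antipode_lTensor_comul := by
    apply hom_ext
    intro g h
    simp only [LinearMap.comp_apply, comul_e, counit_e, map_sum, LinearMap.lTensor_tmul, lift_e,
      LinearMap.mul'_apply, e_mul_e, Algebra.linearMap_apply]
    rw [Algebra.algebraMap_eq_smul_one, one_def]
    have key : ∀ a : G, (a⁻¹ * g = h * (h⁻¹ * a⁻¹ * h) * h⁻¹) ↔ g = 1 := by
      intro a
      simp [mul_assoc]
    simp only [key]
    by_cases hg : g = 1
    · subst hg
      simp only [if_true, one_smul]
      exact Fintype.sum_equiv (Equiv.inv G) _ _ fun a => by simp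
    · simp [hg]

end Structure

end DrinfeldDouble

/-! ### Hopf automorphisms -/

/-- The Hopf algebra automorphisms of `H`: the bijective maps that are morphisms of algebras and of
coalgebras (such maps commute with the antipode). -/
abbrev HopfAut (k H : Type*) [Field k] [Ring H] [HopfAlgebra k H] : Type _ := H ≃ₐc[k] H

/-- Hopf automorphisms form a group under composition. -/
instance HopfAut.instGroup {k H : Type*} [Field k] [Ring H] [HopfAlgebra k H] :
    Group (HopfAut k H) where
  mul f g := BialgEquiv.trans g f
  one := BialgEquiv.refl k H
  inv f := f.symm
  mul_assoc _ _ _ := rfl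
  one_mul _ := rfl
  mul_one _ := rfl
  inv_mul_cancel f := BialgEquiv.ext fun x => f.symm_apply_apply x

theorem HopfAut.mul_apply {k H : Type*} [Field k] [Ring H] [HopfAlgebra k H]
    (f g : HopfAut k H) (x : H) : (f * g) x = f (g x) := rfl

theorem HopfAut.one_apply {k H : Type*} [Field k] [Ring H] [HopfAlgebra k H]
    (x : H) : (1 : HopfAut k H) x = x := rfl

namespace DrinfeldDouble

section Aut

set_option linter.unusedSectionVars false

variable {k G : Type*} [Field k] [Group G] [Fintype G] [DecidableEq G]

/-! ### The components `r` and `v` of a Hopf endomorphism, and the subgroup `Λ_c(G)` -/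

/-- `id ⊗ ε : D(G) → k^G`. -/
noncomputable def idTensorCounit : DrinfeldDouble k G →ₗ[k] (G → k) :=
  lift fun g _ => Pi.single g 1

/-- `ev₁ ⊗ id : D(G) → kG`, where `ev₁` is evaluation at the identity of `G`. -/
noncomputable def evOneTensorId : DrinfeldDouble k G →ₗ[k] MonoidAlgebra k G :=
  lift fun g h => if g = 1 then MonoidAlgebra.single h 1 else 0

/-- The component `r : G → k^G` of `ψ = (p, u, r, v)`: `r(g) = (id ⊗ ε)(ψ(ε # g))`. -/
noncomputable def rComp (ψ : HopfAut k (DrinfeldDouble k G)) (g : G) : G → k :=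
  idTensorCounit (ψ (ofGroup k g))

/-- The component `v : G → kG` of `ψ = (p, u, r, v)`: `v(g) = (ev₁ ⊗ id)(ψ(ε # g))`. -/
noncomputable def vComp (ψ : HopfAut k (DrinfeldDouble k G)) (g : G) : MonoidAlgebra k G :=
  evOneTensorId (ψ (ofGroup k g))

/-- `ψ` has the form `(p, u, 1, id)`: `r` is the trivial map `g ↦ ε` (`ε` is the constant
function `1` on `G`), and `v` is the identity map. -/
def HasTrivialRIdV (ψ : HopfAut k (DrinfeldDouble k G)) : Prop :=
  (∀ g : G, rComp ψ g = fun _ => 1) ∧ (∀ g : G, vComp ψ g = MonoidAlgebra.single g 1)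

theorem comul_ofGroup (g : G) :
    Coalgebra.comul (R := k) (ofGroup k g) = ofGroup k g ⊗ₜ[k] ofGroup k g := by
  simp only [ofGroup, map_sum, comul_e, TensorProduct.sum_tmul, TensorProduct.tmul_sum]
  rw [Finset.sum_comm]
  refine Finset.sum_congr rfl fun a _ => ?_
  exact Fintype.sum_equiv (Equiv.mulLeft a⁻¹) _ _ (fun b => rfl)

/-- Reassembling `D(G)` from `k^G ⊗ kG`. -/
noncomputable def join : (G → k) →ₗ[k] MonoidAlgebra k G →ₗ[k] DrinfeldDouble k G :=
  LinearMap.mk₂ k (fun f x => ∑ g : G, ∑ h : G, (f g * x.coeff h) • e k g h)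
    (by intros; simp [add_mul, add_smul, Finset.sum_add_distrib])
    (by intros; simp [mul_assoc, Finset.smul_sum, smul_smul])
    (by intros; simp [mul_add, add_smul, Finset.sum_add_distrib])
    (by intros; simp [mul_left_comm, Finset.smul_sum, smul_smul])

theorem join_single (f : G → k) (h : G) :
    join f (MonoidAlgebra.single h 1) = ∑ g : G, f g • e k g h := by
  simp only [join, LinearMap.mk₂_apply]
  refine Finset.sum_congr rfl fun g _ => ?_
  rw [Finset.sum_eq_single h]
  · simp
  · intro b _ hb
    simp [Ne.symm hb]
  · simp

theorem join_comul (x : DrinfeldDouble k G) :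
    TensorProduct.lift (join (k := k) (G := G)) (TensorProduct.map idTensorCounit evOneTensorId
      (Coalgebra.comul (R := k) x)) = x := by
  have : (TensorProduct.lift (join (k := k) (G := G))) ∘ₗ
      (TensorProduct.map idTensorCounit evOneTensorId) ∘ₗ Coalgebra.comul (R := k) =
      LinearMap.id := by
    apply hom_ext
    intro g h
    simp only [LinearMap.comp_apply, comul_e, map_sum, TensorProduct.map_tmul,
      TensorProduct.lift.tmul, idTensorCounit, evOneTensorId, lift_e, LinearMap.id_apply]
    rw [Finset.sum_eq_single 1]
    · rw [if_pos rfl, join_single, Finset.sum_eq_single g]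
      · simp
      · intro b _ hb
        simp [hb]
      · simp
    · intro b _ hb
      rw [if_neg hb, map_zero]
    · simp
  exact DFunLike.congr_fun this x

theorem comul_map (ψ : HopfAut k (DrinfeldDouble k G)) (x : DrinfeldDouble k G) :
    Coalgebra.comul (R := k) (ψ x) = TensorProduct.map (ψ : DrinfeldDouble k G →ₗ[k] _)
      (ψ : DrinfeldDouble k G →ₗ[k] _) (Coalgebra.comul (R := k) x) :=
  (CoalgHomClass.map_comp_comul_apply ψ x).symm

/-- The automorphisms `(p, u, 1, id)` are those that fix `1 × G` pointwise. -/
theorem hasTrivialRIdV_iff (ψ : HopfAut k (DrinfeldDouble k G)) :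
    HasTrivialRIdV ψ ↔ ∀ g : G, ψ (ofGroup k g) = ofGroup k g := by
  constructor
  · rintro ⟨hr, hv⟩ g
    have h := join_comul (ψ (ofGroup k g))
    rw [comul_map, comul_ofGroup] at h
    rw [← h]
    simp only [TensorProduct.map_tmul, TensorProduct.lift.tmul]
    have h1 := hr g
    have h2 := hv g
    unfold rComp at h1
    unfold vComp at h2
    have h3 : join (idTensorCounit (ψ (ofGroup k g))) (evOneTensorId (ψ (ofGroup k g))) =
        ofGroup k g := by
      rw [h1, h2, join_single]
      simp [ofGroup]
    exact h3
  · intro h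
    refine ⟨fun g => ?_, fun g => ?_⟩
    · unfold rComp
      rw [h g]
      ext x
      simp [ofGroup, idTensorCounit, Pi.single_apply]
    · unfold vComp
      rw [h g]
      simp [ofGroup, evOneTensorId]

variable (k G) in
/-- The subgroup `Λ_c(G)` of `Aut(D(G))` of all automorphisms of the form `(p, u, 1, id)`. -/
def LambdaC : Subgroup (HopfAut k (DrinfeldDouble k G)) where
  carrier := {ψ | HasTrivialRIdV ψ}
  mul_mem' := by
    intro a b ha hb
    simp only [Set.mem_ofPred_eq, hasTrivialRIdV_iff] at *
    intro g
    rw [HopfAut.mul_apply, hb, ha]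
  one_mem' := by
    simp only [Set.mem_ofPred_eq, hasTrivialRIdV_iff]
    intro g
    rfl
  inv_mem' := by
    intro a ha
    simp only [Set.mem_ofPred_eq, hasTrivialRIdV_iff] at *
    intro g
    have h : a⁻¹ (a (ofGroup k g)) = ofGroup k g := a.symm_apply_apply _
    rwa [ha g] at h

theorem mem_LambdaC_iff (ψ : HopfAut k (DrinfeldDouble k G)) :
    ψ ∈ LambdaC k G ↔ ∀ g : G, ψ (ofGroup k g) = ofGroup k g :=
  hasTrivialRIdV_iff ψ

/-! ### The subgroup `BCh(G) ⋊ Aut(G)` -/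

variable (k G) in
/-- The group of bicharacters `G × G → kˣ`, written as the homomorphisms `r : G → Ĝ` into the
group of linear characters of `G`; `r h g` is the value of the bicharacter at `(h, g)`. -/
abbrev BCh : Type _ := G →* (G →* kˣ)

/-- The linear map `e_g # h ↦ r(h) (e_g # h) = r(h)(g) • (e_g # h)`. -/
noncomputable def bchLin (r : BCh k G) : DrinfeldDouble k G →ₗ[k] DrinfeldDouble k G :=
  lift fun g h => ((r h g : kˣ) : k) • e k g h

/-- The linear map `e_g # h ↦ e_{v(g)} # v(h)`. -/
noncomputable def autLin (v : MulAut G) : DrinfeldDouble k G →ₗ[k] DrinfeldDouble k G :=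
  lift fun g h => e k (v g) (v h)

/-- A multiplicative and comultiplicative linear bijection, given with its inverse on the
basis, is a Hopf automorphism. -/
noncomputable def mkAut (f f' : DrinfeldDouble k G →ₗ[k] DrinfeldDouble k G)
    (h₁ : ∀ g h, f' (f (e k g h)) = e k g h) (h₂ : ∀ g h, f (f' (e k g h)) = e k g h)
    (hmul : ∀ g h g' h', f (e k g h * e k g' h') = f (e k g h) * f (e k g' h'))
    (hcounit : ∀ g h, Coalgebra.counit (R := k) (f (e k g h)) =
      Coalgebra.counit (R := k) (e k g h))
    (hcomul : ∀ g h, TensorProduct.map f f (Coalgebra.comul (R := k) (e k g h)) =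
      Coalgebra.comul (R := k) (f (e k g h))) :
    HopfAut k (DrinfeldDouble k G) :=
  { f with
    invFun := f'
    left_inv := fun x => DFunLike.congr_fun
      (hom_ext (f := f' ∘ₗ f) (f' := LinearMap.id) h₁) x
    right_inv := fun x => DFunLike.congr_fun
      (hom_ext (f := f ∘ₗ f') (f' := LinearMap.id) h₂) x
    map_mul' := fun x y => by
      have : (LinearMap.mul k (DrinfeldDouble k G)).compr₂ f =
          (LinearMap.mul k (DrinfeldDouble k G)).compl₁₂ f f := by
        apply hom_ext; intro g h; apply hom_ext; intro g' h'
        exact hmul g h g' h'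
      exact DFunLike.congr_fun (DFunLike.congr_fun this x) y
    counit_comp := hom_ext hcounit
    map_comp_comul := hom_ext hcomul }

theorem mkAut_apply (f f' : DrinfeldDouble k G →ₗ[k] DrinfeldDouble k G) (h₁ h₂ h₃ h₄ h₅)
    (x : DrinfeldDouble k G) : mkAut f f' h₁ h₂ h₃ h₄ h₅ x = f x := rfl

/-- Hopf automorphisms are determined by their values on the basis. -/
theorem aut_ext {ψ ψ' : HopfAut k (DrinfeldDouble k G)}
    (h : ∀ a b, ψ (e k a b) = ψ' (e k a b)) : ψ = ψ' :=
  BialgEquiv.ext fun x => DFunLike.congr_fun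
    (hom_ext (f := (ψ : DrinfeldDouble k G →ₗ[k] DrinfeldDouble k G))
      (f' := (ψ' : DrinfeldDouble k G →ₗ[k] DrinfeldDouble k G)) h) x

variable (k G) in
/-- The embedding of `BCh(G)` into `Aut(D(G))`; `r` acts by `e_g # h ↦ r(h) e_g # h`. -/
noncomputable def bchEmb : BCh k G →* HopfAut k (DrinfeldDouble k G) where
  toFun r := mkAut (bchLin r) (bchLin r⁻¹)
    (by intro g h; simp [bchLin, smul_smul])
    (by intro g h; simp [bchLin, smul_smul])
    (by
      intro g h g' h'
      simp only [bchLin, lift_e, e_mul_e, smul_mul_smul_comm]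
      by_cases h1 : g = h * g' * h⁻¹
      · have h2 : r h' g = r h' g' := by
          rw [h1]; simp
        simp only [if_pos h1, lift_e, map_mul, MonoidHom.mul_apply, Units.val_mul, h2]
      · simp [if_neg h1])
    (by
      intro g h
      simp only [bchLin, lift_e, map_smul, counit_e]
      by_cases h1 : g = 1
      · subst h1; simp
      · simp [h1])
    (by
      intro g h
      simp only [bchLin, lift_e, map_smul, comul_e, map_sum, TensorProduct.map_tmul,
        TensorProduct.smul_tmul_smul, Finset.smul_sum]
      refine Finset.sum_congr rfl fun a _ => ?_
      congr 1
      rw [← Units.val_mul, ← map_mul]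
      rw [show r h (a⁻¹ * g * a) = r h g by simp [mul_comm]])
  map_one' := aut_ext fun g h => by simp [mkAut_apply, HopfAut.one_apply, bchLin]
  map_mul' r s := aut_ext fun g h => by
    simp [mkAut_apply, HopfAut.mul_apply, bchLin, smul_smul, mul_comm]

variable (k G) in
/-- The embedding of `Aut(G)` into `Aut(D(G))`; `v` acts by `e_g # h ↦ e_{v(g)} # v(h)`. -/
noncomputable def autEmb : MulAut G →* HopfAut k (DrinfeldDouble k G) where
  toFun v := mkAut (autLin v) (autLin v⁻¹)
    (by intro g h; simp [autLin])
    (by intro g h; simp [autLin])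
    (by
      intro g h g' h'
      simp only [autLin, lift_e, e_mul_e]
      have : v g = v h * v g' * (v h)⁻¹ ↔ g = h * g' * h⁻¹ := by
        rw [← map_inv, ← map_mul, ← map_mul, v.injective.eq_iff]
      simp only [this]
      split_ifs <;> simp)
    (by
      intro g h
      simp only [autLin, lift_e, counit_e, map_eq_one_iff v v.injective])
    (by
      intro g h
      simp only [autLin, lift_e, comul_e, map_sum, TensorProduct.map_tmul]
      exact Fintype.sum_equiv v.toEquiv _ _ fun a => by simp)
  map_one' := aut_ext fun g h => by simp [mkAut_apply, HopfAut.one_apply, autLin]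
  map_mul' v w := aut_ext fun g h => by
    simp [mkAut_apply, HopfAut.mul_apply, autLin]

theorem bchEmb_apply_e (r : BCh k G) (g h : G) :
    bchEmb k G r (e k g h) = ((r h g : kˣ) : k) • e k g h := by
  have h1 : bchEmb k G r (e k g h) = bchLin r (e k g h) := by
    simp only [bchEmb, MonoidHom.coe_mk, OneHom.coe_mk, mkAut_apply]
  rw [h1, bchLin, lift_e]

theorem autEmb_apply_e (v : MulAut G) (g h : G) :
    autEmb k G v (e k g h) = e k (v g) (v h) := by
  have h1 : autEmb k G v (e k g h) = autLin v (e k g h) := by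
    simp only [autEmb, MonoidHom.coe_mk, OneHom.coe_mk, mkAut_apply]
  rw [h1, autLin, lift_e]

variable (k G) in
/-- The action of `Aut(G)` on `BCh(G)`. The right action is `r ^ v = v^* ∘ r ∘ v`, that is
`(r ^ v)(h)(g) = r (v h) (v g)`; the corresponding left action is `v ↦ (r ↦ r ^ (v⁻¹))`. -/
def bchAction : MulAut G →* MulAut (BCh k G) where
  toFun v :=
    { toFun := fun r =>
        { toFun := fun h => (r (v⁻¹ h)).comp (v⁻¹ : MulAut G).toMonoidHom
          map_one' := by ext; simp
          map_mul' := by intros; ext; simp }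
      invFun := fun r =>
        { toFun := fun h => (r (v h)).comp v.toMonoidHom
          map_one' := by ext; simp
          map_mul' := by intros; ext; simp }
      left_inv := by intro r; ext; simp
      right_inv := by intro r; ext; simp
      map_mul' := by intro r s; ext; simp }
  map_one' := by ext; simp
  map_mul' := by intro v w; ext; simp

theorem bchAction_apply (v : MulAut G) (r : BCh k G) (h g : G) :
    bchAction k G v r h g = r (v⁻¹ h) (v⁻¹ g) := rfl

variable (k G) in
/-- The semidirect product `BCh(G) ⋊ Aut(G)`. -/
abbrev BChAut : Type _ := BCh k G ⋊[bchAction k G] MulAut G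

variable (k G) in
/-- The homomorphism `BCh(G) ⋊ Aut(G) → Aut(D(G))` that extends the embeddings of `BCh(G)` and of
`Aut(G)`. -/
noncomputable def bchAutEmb : BChAut k G →* HopfAut k (DrinfeldDouble k G) :=
  SemidirectProduct.lift (bchEmb k G) (autEmb k G) (by
    intro v
    ext r : 1
    refine aut_ext fun g h => ?_
    simp only [MonoidHom.comp_apply, MulEquiv.coe_toMonoidHom, MulAut.conj_apply,
      HopfAut.mul_apply, ← map_inv (autEmb k G), autEmb_apply_e, bchEmb_apply_e,
      bchAction_apply, map_smul, MulAut.apply_inv_self])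

theorem bchAutEmb_apply_e (x : BChAut k G) (g h : G) :
    bchAutEmb k G x (e k g h) =
      ((x.left (x.right h) (x.right g) : kˣ) : k) • e k (x.right g) (x.right h) := by
  change bchEmb k G x.left (autEmb k G x.right (e k g h)) = _
  rw [autEmb_apply_e, bchEmb_apply_e]

/-- `BCh(G) ⋊ Aut(G)` is embedded in `Aut(D(G))`. -/
theorem bchAutEmb_injective : Function.Injective (bchAutEmb k G) := by
  intro x y hxy
  have key : ∀ g h : G, (Finsupp.single (x.right g, x.right h)
      ((x.left (x.right h) (x.right g) : kˣ) : k) : G × G →₀ k) =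
      Finsupp.single (y.right g, y.right h) ((y.left (y.right h) (y.right g) : kˣ) : k) := by
    intro g h
    have h1 : bchAutEmb k G x (e k g h) = bchAutEmb k G y (e k g h) := by rw [hxy]
    rw [bchAutEmb_apply_e, bchAutEmb_apply_e] at h1
    exact ((Finsupp.smul_single_one _ _).symm.trans h1).trans (Finsupp.smul_single_one _ _)
  have hv : x.right = y.right := by
    ext g
    rcases (Finsupp.single_eq_single_iff _ _ _ _).1 (key g g) with h1 | h1
    · exact (Prod.ext_iff.1 h1.1).1
    · exact absurd h1.1 (Units.ne_zero _)
  have hr : x.left = y.left := by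
    ext h g
    obtain ⟨h', rfl⟩ := x.right.surjective h
    obtain ⟨g', rfl⟩ := x.right.surjective g
    rcases (Finsupp.single_eq_single_iff _ _ _ _).1 (key g' h') with h1 | h1
    · rw [h1.2, hv]
    · exact absurd h1.1 (Units.ne_zero _)
  exact SemidirectProduct.ext hr hv

end Aut

end DrinfeldDouble

/-- `G` is a stem group if its centre is contained in its derived subgroup. -/
def IsStemGroup (G : Type*) [Group G] : Prop := Subgroup.center G ≤ commutator G

/-! The group-like elements of `D(G)` are the `χ # h`, with `χ` a linear character and `h ∈ G`, and
they form the group `Ĝ × G` (`exists_eq_charTensor`, `charTensor_mul`). Every Hopf automorphism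
permutes them, and `Λ_c(G)` is the pointwise stabilizer of `1 × G`.

Let `G` be a stem group. For any automorphism, the component `k^G → kG` kills `e_g` unless `g` is
central (`mem_center_of_evOneTensorId_ne_zero`). Characters are trivial on `G'`, hence on the
centre, so every automorphism preserves `Ĝ × 1`. The restriction of an automorphism to `1 × G` is
then realized by some element of `BCh(G) ⋊ Aut(G)`, which gives the factorization
(`exists_bchAutEmb_mul_mem_LambdaC`). For an element of `Λ_c(G)`, the component `k^G → k^G` is dual
to a map `x ↦ x z(x)` with `z(x)` central (`exists_rowSum_eq_single_mul`). Such a map does not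
change characters, so `Λ_c(G)` fixes all group-likes. As these are permuted by every automorphism,
`Λ_c(G)` is normal.

Conversely, the left factor of a semidirect product is normal, so it remains to contradict normality
when some central `z` lies outside `G'`. Choose a character with `χ(z) ≠ 1` and a bicharacter `r`
with `r(h) = χ`. Normality would force every element of `Λ_c(G)` to fix `χ # h`, the image of `1 #
h` under `r`. A finite Fourier transform along `⟨z⟩` (`twistAut`) lies in `Λ_c(G)` and does not fix
it. -/

namespace DrinfeldDouble

variable {k G : Type*} [Field k] [Group G] [Fintype G] [DecidableEq G]

/-! ### Coordinates and convolution of functionals -/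

/-- The coordinate functional dual to the basis element `e_x # y`. -/
noncomputable def coord (x y : G) : DrinfeldDouble k G →ₗ[k] k :=
  lift fun g h => if g = x ∧ h = y then 1 else 0

theorem coord_e (x y g h : G) :
    coord x y (e k g h) = if g = x ∧ h = y then 1 else 0 := lift_e _ _ _

theorem sum_coord_smul_e (w : DrinfeldDouble k G) :
    ∑ x : G, ∑ y : G, coord x y w • e k x y = w := by
  have : (∑ x : G, ∑ y : G, (coord x y).smulRight (e k x y)) =
      (LinearMap.id : DrinfeldDouble k G →ₗ[k] _) := by
    apply hom_ext
    intro a b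
    simp only [LinearMap.sum_apply, LinearMap.smulRight_apply, coord_e, LinearMap.id_apply]
    rw [Finset.sum_eq_single a, Finset.sum_eq_single b]
    · simp
    · intro y _ hy
      simp [Ne.symm hy]
    · simp
    · intro x _ hx
      simp [Ne.symm hx]
    · simp
  simpa [LinearMap.sum_apply] using DFunLike.congr_fun this w

theorem ext_coord {w w' : DrinfeldDouble k G} (h : ∀ x y, coord x y w = coord x y w') :
    w = w' := by
  rw [← sum_coord_smul_e w, ← sum_coord_smul_e w']
  simp only [h]

/-- The convolution product of two linear functionals, evaluated at `w`. -/
noncomputable def pairing (φ φ' : DrinfeldDouble k G →ₗ[k] k) (w : DrinfeldDouble k G) : k :=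
  LinearMap.mul' k k (TensorProduct.map φ φ' (Coalgebra.comul (R := k) w))

theorem pairing_e (φ φ' : DrinfeldDouble k G →ₗ[k] k) (g h : G) :
    pairing φ φ' (e k g h) = ∑ a : G, φ (e k (a⁻¹ * g) h) * φ' (e k a h) := by
  simp [pairing, comul_e, map_sum]

/-- Convolution makes the dual of `D(G)` the algebra `kG ⊗ k^G`. The arguments are swapped because
the comultiplication is opposite on the factor `k^G`. -/
theorem pairing_coord (x y x' y' : G) (w : DrinfeldDouble k G) :
    pairing (coord x' y') (coord x y) w = if y = y' then coord (x * x') y w else 0 := by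
  have : (LinearMap.mul' k k) ∘ₗ (TensorProduct.map (coord x' y') (coord x y)) ∘ₗ
      Coalgebra.comul (R := k) (A := DrinfeldDouble k G) =
      if y = y' then coord (x * x') y else 0 := by
    apply hom_ext
    intro g h
    change pairing _ _ _ = _
    rw [pairing_e]
    simp only [coord_e]
    rw [Finset.sum_eq_single x]
    · by_cases hy : y = y'
      · subst hy
        by_cases hh : h = y
        · simp [hh, coord_e, inv_mul_eq_iff_eq_mul]
        · simp [hh, coord_e]
      · by_cases hh : h = y
        · subst hh; simp [hy]
        · simp [hy, hh]
    · intro a _ ha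
      simp [ha]
    · simp
  have h2 := DFunLike.congr_fun this w
  split_ifs at h2 ⊢ <;> exact h2

theorem pairing_comp (ψ : HopfAut k (DrinfeldDouble k G)) (φ φ' : DrinfeldDouble k G →ₗ[k] k)
    (w : DrinfeldDouble k G) :
    pairing (φ ∘ₗ (ψ : DrinfeldDouble k G →ₗ[k] _)) (φ' ∘ₗ (ψ : DrinfeldDouble k G →ₗ[k] _)) w =
      pairing φ φ' (ψ w) := by
  rw [pairing, pairing, comul_map, TensorProduct.map_comp, LinearMap.comp_apply]

theorem counit_eq_sum_coord (w : DrinfeldDouble k G) :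
    Coalgebra.counit (R := k) w = ∑ y : G, coord 1 y w := by
  have : Coalgebra.counit (R := k) (A := DrinfeldDouble k G) = ∑ y : G, coord 1 y := by
    apply hom_ext
    intro g h
    by_cases hg : g = 1 <;> simp [counit_e, LinearMap.sum_apply, coord_e, hg]
  rw [this, LinearMap.sum_apply]

/-! ### Group-like elements -/

/-- The element `χ # h`, for a linear character `χ` of `G`. -/
noncomputable def charTensor (χ : G →* kˣ) (h : G) : DrinfeldDouble k G :=
  ∑ x : G, (χ x : k) • e k x h

theorem coord_charTensor (χ : G →* kˣ) (h x y : G) :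
    coord x y (charTensor χ h) = if h = y then (χ x : k) else 0 := by
  simp only [charTensor, map_sum, map_smul, coord_e]
  rw [Finset.sum_eq_single x]
  · simp
  · intro b _ hb
    simp [hb]
  · simp

theorem charTensor_one (h : G) : charTensor 1 h = ofGroup k h := by
  simp [charTensor, ofGroup]

theorem charTensor_injective {χ χ' : G →* kˣ} {h h' : G}
    (H : charTensor χ h = charTensor χ' h') : χ = χ' ∧ h = h' := by
  have key : ∀ x : G, h = h' ∧ χ x = χ' x := by
    intro x
    have h1 := congrArg (coord x h) H
    rw [coord_charTensor, coord_charTensor, if_pos rfl] at h1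
    split_ifs at h1 with h2
    · exact ⟨h2.symm, Units.ext h1⟩
    · exact absurd h1 (Units.ne_zero _)
  exact ⟨MonoidHom.ext fun x => (key x).2, (key 1).1⟩

/-- Linear characters are invariant under conjugation, so the twist in the multiplication of `D(G)`
has no effect on them. -/
theorem charTensor_mul (χ χ' : G →* kˣ) (h h' : G) :
    charTensor χ h * charTensor χ' h' = charTensor (χ * χ') (h * h') := by
  simp only [charTensor, Finset.sum_mul, Finset.mul_sum, smul_mul_smul_comm, e_mul_e]
  rw [Finset.sum_comm]
  refine Finset.sum_congr rfl fun x _ => ?_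
  rw [Finset.sum_eq_single (h⁻¹ * x * h)]
  · have h1 : h * (h⁻¹ * x * h) * h⁻¹ = x := by group
    have h2 : χ' (h⁻¹ * x * h) = χ' x := by simp [mul_comm]
    rw [h1, if_pos rfl, h2]
    simp
  · intro b _ hb
    rw [if_neg, smul_zero]
    rintro rfl
    exact hb (by group)
  · simp

theorem comul_charTensor (χ : G →* kˣ) (h : G) :
    Coalgebra.comul (R := k) (charTensor χ h) = charTensor χ h ⊗ₜ[k] charTensor χ h := by
  simp only [charTensor, map_sum, map_smul, comul_e, TensorProduct.sum_tmul,
    TensorProduct.tmul_sum, Finset.smul_sum]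
  rw [Finset.sum_comm]
  refine Finset.sum_congr rfl fun a _ => ?_
  refine Fintype.sum_equiv (Equiv.mulLeft a⁻¹) _ _ fun b => ?_
  have h1 : χ b = χ (a⁻¹ * b) * χ a := by simp [mul_comm]
  rw [TensorProduct.smul_tmul_smul, h1, Units.val_mul]
  rfl

theorem counit_charTensor (χ : G →* kˣ) (h : G) :
    Coalgebra.counit (R := k) (charTensor χ h) = 1 := by
  simp [charTensor, counit_e]

/-- Pairing `w ⊗ w` with coordinates gives `c(x,y) c(x',y') = δ_{y,y'} c(xx',y)`. Counit `1`
supplies a column `h` with `c(1,h) ≠ 0`; this idempotent scalar is `1`, so column `h` is a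
character, and orthogonality to it kills all other columns. -/
theorem exists_eq_charTensor {w : DrinfeldDouble k G}
    (hw : Coalgebra.comul (R := k) w = w ⊗ₜ[k] w) (hw1 : Coalgebra.counit (R := k) w = 1) :
    ∃ (χ : G →* kˣ) (h : G), w = charTensor χ h := by
  have hmul : ∀ x y x' y', coord x y w * coord x' y' w =
      if y = y' then coord (x * x') y w else 0 := by
    intro x y x' y'
    rw [← pairing_coord, pairing, hw, TensorProduct.map_tmul, LinearMap.mul'_apply, mul_comm]
  rw [counit_eq_sum_coord] at hw1
  obtain ⟨h, -, hh⟩ := Finset.exists_ne_zero_of_sum_ne_zero (hw1.trans_ne one_ne_zero)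
  have hh1 : coord 1 h w = 1 := by
    have := hmul 1 h 1 h
    rw [if_pos rfl, mul_one] at this
    exact mul_left_cancel₀ hh (this.trans (mul_one _).symm)
  let χ : G →* k :=
    { toFun := fun x => coord x h w
      map_one' := hh1
      map_mul' := fun x x' => by rw [hmul, if_pos rfl] }
  refine ⟨χ.toHomUnits, h, ext_coord fun x y => ?_⟩
  rw [coord_charTensor]
  split_ifs with hy
  · subst hy; rfl
  · have := hmul x y 1 h
    rwa [if_neg (Ne.symm hy), hh1, mul_one] at this

theorem exists_map_charTensor (ψ : HopfAut k (DrinfeldDouble k G)) (χ : G →* kˣ) (h : G) :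
    ∃ (χ' : G →* kˣ) (h' : G), ψ (charTensor χ h) = charTensor χ' h' := by
  refine exists_eq_charTensor ?_ ?_
  · rw [comul_map, comul_charTensor, TensorProduct.map_tmul]
    rfl
  · exact (CoalgHomClass.counit_comp_apply ψ _).trans (counit_charTensor χ h)

/-! ### Restriction of functionals to the subcoalgebra `k^G` -/

variable (k G) in
/-- The restriction of a linear functional to `k^G # 1`, as an element of `kG`. -/
noncomputable def restrict : (DrinfeldDouble k G →ₗ[k] k) →ₗ[k] MonoidAlgebra k G where
  toFun φ := ∑ g : G, φ (e k g 1) • MonoidAlgebra.single g 1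
  map_add' := by intros; simp [add_smul, Finset.sum_add_distrib]
  map_smul' := by intros; simp [Finset.smul_sum]

theorem restrict_apply (φ : DrinfeldDouble k G →ₗ[k] k) :
    restrict k G φ = ∑ g : G, φ (e k g 1) • MonoidAlgebra.single g 1 := rfl

theorem coeff_restrict (φ : DrinfeldDouble k G →ₗ[k] k) (g : G) :
    (restrict k G φ).coeff g = φ (e k g 1) := by
  rw [restrict_apply, MonoidAlgebra.coeff_sum, Finsupp.finsetSum_apply,
    Finset.sum_eq_single g]
  · simp
  · intro b _ hb
    simp [hb]
  · simp

/-- Restriction to `k^G # 1` turns convolution, with the factors exchanged, into the product of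
`kG`. -/
theorem coeff_restrict_mul (φ φ' : DrinfeldDouble k G →ₗ[k] k) (g : G) :
    (restrict k G φ * restrict k G φ').coeff g = pairing φ' φ (e k g 1) := by
  rw [pairing_e, restrict_apply φ, Finset.sum_mul, MonoidAlgebra.coeff_sum,
    Finsupp.finsetSum_apply]
  refine Finset.sum_congr rfl fun a _ => ?_
  simp [coeff_restrict, MonoidAlgebra.coeff_single_mul_apply, mul_comm]

theorem restrict_coord_one (g : G) :
    restrict k G (coord g 1) = MonoidAlgebra.single g 1 := by
  rw [restrict_apply, Finset.sum_eq_single g]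
  · simp [coord_e]
  · intro b _ hb
    simp [coord_e, hb]
  · simp

/-! ### Matrix coefficients of an automorphism on `k^G` -/

/-- The coefficients of `e_x # y` in the elements `ψ(e_g # 1)`, as an element of `kG`. -/
noncomputable def matrixCoeff (ψ : HopfAut k (DrinfeldDouble k G)) (x y : G) :
    MonoidAlgebra k G :=
  restrict k G (coord x y ∘ₗ (ψ : DrinfeldDouble k G →ₗ[k] DrinfeldDouble k G))

theorem coeff_matrixCoeff (ψ : HopfAut k (DrinfeldDouble k G)) (x y g : G) :
    (matrixCoeff ψ x y).coeff g = coord x y (ψ (e k g 1)) := coeff_restrict _ _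

/-- This is the transpose of `ψ` restricted to `k^G`, viewed as an algebra map from `kG ⊗ k^G` to
`kG`. In particular the coefficients with `x = 1` are orthogonal idempotents. -/
theorem matrixCoeff_mul (ψ : HopfAut k (DrinfeldDouble k G)) (x y x' y' : G) :
    matrixCoeff ψ x y * matrixCoeff ψ x' y' =
      if y = y' then matrixCoeff ψ (x * x') y else 0 := by
  ext g
  rw [matrixCoeff, matrixCoeff, coeff_restrict_mul, pairing_comp, pairing_coord]
  split_ifs
  · rw [coeff_matrixCoeff]
  · simp

/-- Since `ψ` is bijective, the functionals `coord x y ∘ ψ` span the dual of `D(G)`. Hence the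
matrix coefficients span `kG`, and commuting with them is commuting with everything. -/
theorem commute_of_commute_matrixCoeff (ψ : HopfAut k (DrinfeldDouble k G))
    {c : MonoidAlgebra k G} (hc : ∀ x y, Commute c (matrixCoeff ψ x y)) (g : G) :
    Commute c (MonoidAlgebra.single g 1) := by
  have h : coord g 1 = ∑ x : G, ∑ y : G, coord g 1 (ψ⁻¹ (e k x y)) •
      (coord x y ∘ₗ (ψ : DrinfeldDouble k G →ₗ[k] DrinfeldDouble k G)) := by
    ext w
    have h1 : w = ψ⁻¹ (ψ w) := (ψ.symm_apply_apply w).symm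
    conv_lhs => rw [h1, ← sum_coord_smul_e (ψ w)]
    simp [map_sum, LinearMap.sum_apply, mul_comm]
  rw [← restrict_coord_one, h, map_sum]
  refine Commute.sum_right _ _ _ fun x _ => ?_
  rw [map_sum]
  refine Commute.sum_right _ _ _ fun y _ => ?_
  rw [map_smul]
  exact (hc x y).smul_right _

/-- The functionals `coord 1 y` are central for convolution, so their images are central in `kG`. -/
theorem commute_matrixCoeff_one (ψ : HopfAut k (DrinfeldDouble k G)) (y g : G) :
    Commute (matrixCoeff ψ 1 y) (MonoidAlgebra.single g 1) := by
  refine commute_of_commute_matrixCoeff ψ (fun x y' => ?_) g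
  rw [Commute, SemiconjBy, matrixCoeff_mul, matrixCoeff_mul]
  simp only [one_mul, mul_one, eq_comm (a := y)]
  split_ifs with h
  · rw [h]
  · rfl

theorem sum_matrixCoeff_one (ψ : HopfAut k (DrinfeldDouble k G)) :
    ∑ y : G, matrixCoeff ψ 1 y = 1 := by
  ext g
  rw [MonoidAlgebra.coeff_sum, Finsupp.finsetSum_apply]
  simp only [coeff_matrixCoeff]
  rw [← counit_eq_sum_coord]
  refine (CoalgHomClass.counit_comp_apply ψ _).trans ?_
  rw [counit_e, MonoidAlgebra.one_def, MonoidAlgebra.coeff_single, Finsupp.single_apply]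
  simp [eq_comm]

/-! ### The component `k^G → kG` is supported on the centre -/

/-- The condition `g = 1` is stable under conjugation, so the `e_g # h` with `g ≠ 1` span an ideal,
with quotient `kG`. -/
theorem evOneTensorId_mul (w w' : DrinfeldDouble k G) :
    evOneTensorId (w * w') = evOneTensorId w * evOneTensorId w' := by
  have : (LinearMap.mul k (DrinfeldDouble k G)).compr₂ evOneTensorId =
      (LinearMap.mul k (MonoidAlgebra k G)).compl₁₂ evOneTensorId evOneTensorId := by
    apply hom_ext; intro g h; apply hom_ext; intro g' h'
    simp only [LinearMap.compr₂_apply, LinearMap.mul_apply', LinearMap.compl₁₂_apply,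
      e_mul_e, evOneTensorId, lift_e]
    by_cases h1 : g = h * g' * h⁻¹
    · subst h1
      by_cases h2 : g' = 1 <;> simp [h2, MonoidAlgebra.single_mul_single]
    · rw [if_neg h1]
      by_cases h2 : g' = 1
      · subst h2
        have : g ≠ 1 := by simpa using h1
        simp [this]
      · simp [h2]
  exact DFunLike.congr_fun (DFunLike.congr_fun this w) w'

theorem coeff_evOneTensorId (w : DrinfeldDouble k G) (y : G) :
    (evOneTensorId w).coeff y = coord 1 y w := by
  induction w using induction_e with
  | h0 => simp
  | hadd x x' hx hx' => simp [hx, hx']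
  | hsmul c x hx => simp [hx]
  | he a b =>
    by_cases h : a = 1 <;> simp [evOneTensorId, coord_e, h, Finsupp.single_apply]

theorem evOneTensorId_charTensor (χ : G →* kˣ) (h : G) :
    evOneTensorId (charTensor χ h) = MonoidAlgebra.single h 1 := by
  ext y
  simp [coeff_evOneTensorId, coord_charTensor, Finsupp.single_apply]

theorem e_one_mul_e_one (g g' : G) :
    e k g 1 * e k g' 1 = if g = g' then e k g 1 else 0 := by
  simp [e_mul_e]

/-- The central elements `matrixCoeff ψ 1 y` have coefficients constant on conjugacy classes, so
`e_g` and its conjugates have the same image. For distinct conjugates these images are orthogonal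
idempotents, hence zero. -/
theorem mem_center_of_evOneTensorId_ne_zero (ψ : HopfAut k (DrinfeldDouble k G)) {g : G}
    (hg : evOneTensorId (ψ (e k g 1)) ≠ 0) : g ∈ Subgroup.center G := by
  rw [Subgroup.mem_center_iff]
  intro h
  by_contra hne
  apply hg
  have hconj : evOneTensorId (ψ (e k (h * g * h⁻¹) 1)) = evOneTensorId (ψ (e k g 1)) := by
    ext y
    rw [coeff_evOneTensorId, coeff_evOneTensorId, ← coeff_matrixCoeff, ← coeff_matrixCoeff]
    have := congrArg (fun t => t.coeff (h * g)) (commute_matrixCoeff_one ψ y h).eq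
    simpa [MonoidAlgebra.coeff_mul_single_apply, MonoidAlgebra.coeff_single_mul_apply] using this
  have h0 := evOneTensorId_mul (ψ (e k g 1)) (ψ (e k g 1))
  have h1 := evOneTensorId_mul (ψ (e k (h * g * h⁻¹) 1)) (ψ (e k g 1))
  rw [← map_mul, e_one_mul_e_one, if_pos rfl] at h0
  rw [← map_mul, e_one_mul_e_one, if_neg (by rwa [mul_inv_eq_iff_eq_mul]), hconj, ← h0] at h1
  simpa using h1.symm

/-- Only central `g` contribute to the `kG`-component of `ψ(χ # 1)`, and there `χ(g) = 1` as `Z(G) ≤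
G'`. So this component equals that of `ψ(1)`, namely `1`. -/
theorem exists_map_charTensor_one (hG : IsStemGroup G) (ψ : HopfAut k (DrinfeldDouble k G))
    (χ : G →* kˣ) : ∃ χ' : G →* kˣ, ψ (charTensor χ 1) = charTensor χ' 1 := by
  obtain ⟨χ', h, hχ⟩ := exists_map_charTensor ψ χ 1
  refine ⟨χ', ?_⟩
  have h1 : evOneTensorId (ψ (charTensor χ 1)) = evOneTensorId (ψ 1) := by
    rw [one_def, charTensor]
    simp only [map_sum, map_smul]
    refine Finset.sum_congr rfl fun g _ => ?_
    by_cases h0 : evOneTensorId (ψ (e k g 1)) = 0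
    · rw [h0, smul_zero]
    · have h3 : χ g = 1 := Abelianization.commutator_subset_ker χ
        (hG (mem_center_of_evOneTensorId_ne_zero ψ h0))
      simp [h3]
  have h2 : (1 : DrinfeldDouble k G) = charTensor 1 1 := (charTensor_one 1).symm
  rw [hχ, map_one, h2, evOneTensorId_charTensor, evOneTensorId_charTensor] at h1
  have h3 := congrArg (fun t => t.coeff h) h1
  have h4 : 1 = h := by
    by_contra hne
    simp [hne] at h3
  rw [hχ, ← h4]

/-! ### Stem groups: the factorization of automorphisms -/

theorem bchAutEmb_ofGroup (x : BChAut k G) (g : G) :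
    bchAutEmb k G x (ofGroup k g) = charTensor (x.left (x.right g)) (x.right g) := by
  simp only [ofGroup, charTensor, map_sum, bchAutEmb_apply_e]
  exact Fintype.sum_equiv x.right.toEquiv _ _ fun a => rfl

/-- The two subgroups meet trivially: `(r, v)` sends `1 # g` to `r(v(g)) # v(g)`, from which `v` and
then `r` can be read off. -/
theorem bchAutEmb_mem_LambdaC {x : BChAut k G} (hx : bchAutEmb k G x ∈ LambdaC k G) : x = 1 := by
  rw [mem_LambdaC_iff] at hx
  have h : ∀ g, x.left (x.right g) = 1 ∧ x.right g = g := fun g =>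
    charTensor_injective ((bchAutEmb_ofGroup x g).symm.trans
      ((hx g).trans (charTensor_one g).symm))
  refine SemidirectProduct.ext (MonoidHom.ext fun g => ?_) (MulEquiv.ext fun g => (h g).2)
  simpa [(h g).2] using (h g).1

theorem exists_bchAutEmb_mul_mem_LambdaC (hG : IsStemGroup G)
    (ψ : HopfAut k (DrinfeldDouble k G)) :
    ∃ x : BChAut k G, (bchAutEmb k G x)⁻¹ * ψ ∈ LambdaC k G := by
  choose ρ v hρ using fun g => exists_map_charTensor ψ 1 g
  have hone : ρ 1 = 1 ∧ v 1 = 1 := by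
    refine charTensor_injective ?_
    rw [← hρ, charTensor_one]
    exact map_one ψ
  have hmul : ∀ g g', ρ (g * g') = ρ g * ρ g' ∧ v (g * g') = v g * v g' := by
    intro g g'
    refine charTensor_injective ?_
    rw [← hρ, ← charTensor_mul, ← hρ, ← hρ, ← map_mul, charTensor_mul]
    exact congrArg (fun χ => ψ (charTensor χ (g * g'))) (one_mul (1 : G →* kˣ)).symm
  let v' : G →* G := ⟨⟨v, hone.2⟩, fun g g' => (hmul g g').2⟩
  -- If `v(g) = 1`, then `ψ(1 # g)` lies in `Ĝ × 1`. The inverse of `ψ` preserves `Ĝ × 1`, so `g =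
  -- 1`.
  have hinj : Function.Injective v' := by
    refine (injective_iff_map_eq_one v').2 fun g hg => ?_
    have hg : v g = 1 := hg
    obtain ⟨χ, hχ⟩ := exists_map_charTensor_one hG ψ⁻¹ (ρ g)
    have h1 := hρ g
    rw [hg] at h1
    rw [← h1] at hχ
    have h2 : ψ⁻¹ (ψ (charTensor 1 g)) = charTensor 1 g := ψ.symm_apply_apply _
    exact (charTensor_injective (h2.symm.trans hχ)).2
  let e' : MulAut G := MulEquiv.ofBijective v' (Finite.injective_iff_bijective.1 hinj)
  let ρ' : G →* (G →* kˣ) := ⟨⟨ρ, hone.1⟩, fun g g' => (hmul g g').1⟩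
  -- In `BCh(G) ⋊ Aut(G)` the automorphism acts first, so the bicharacter is evaluated at `v(g)`;
  -- precomposing `ρ` with `v⁻¹` compensates.
  refine ⟨⟨ρ'.comp (e'⁻¹ : MulAut G).toMonoidHom, e'⟩, ?_⟩
  rw [mem_LambdaC_iff]
  intro g
  set x : BChAut k G := ⟨ρ'.comp (e'⁻¹ : MulAut G).toMonoidHom, e'⟩
  have h1 : ψ (ofGroup k g) = bchAutEmb k G x (ofGroup k g) := by
    rw [bchAutEmb_ofGroup, ← charTensor_one, hρ]
    have h2 : x.left (x.right g) = ρ g := by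
      change ρ' (e'⁻¹ (e' g)) = ρ g
      rw [MulAut.inv_apply_self]
      rfl
    rw [h2]
    rfl
  rw [HopfAut.mul_apply, h1]
  exact (bchAutEmb k G x).symm_apply_apply _

/-! ### Stem groups: normality of `Λ_c(G)` -/

theorem ofGroup_mul_e (g x y : G) :
    ofGroup k g * e k x y = e k (g * x * g⁻¹) (g * y) := by
  rw [ofGroup, Finset.sum_mul]
  simp_rw [e_mul_e]
  simp

theorem e_mul_ofGroup (g x y : G) :
    e k x y * ofGroup k g = e k x (y * g) := by
  rw [ofGroup, Finset.mul_sum]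
  simp_rw [e_mul_e]
  rw [Finset.sum_eq_single (y⁻¹ * x * y)]
  · rw [if_pos (by group)]
  · intro b _ hb
    rw [if_neg]
    rintro rfl
    exact hb (by group)
  · simp

theorem coord_conj (g x y : G) (w : DrinfeldDouble k G) :
    coord (g * x * g⁻¹) (g * y * g⁻¹) (ofGroup k g * w * ofGroup k g⁻¹) = coord x y w := by
  induction w using induction_e with
  | h0 => simp
  | hadd x x' hx hx' => simp [mul_add, add_mul, hx, hx']
  | hsmul c x hx => simp [hx]
  | he a b => simp [ofGroup_mul_e, e_mul_ofGroup, coord_e]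

/-- An element of `Λ_c(G)` fixes every `1 # g`, so it commutes with conjugation by `1 # g`. -/
theorem matrixCoeff_conj {ψ : HopfAut k (DrinfeldDouble k G)} (hψ : ψ ∈ LambdaC k G)
    (g x y : G) : matrixCoeff ψ (g * x * g⁻¹) (g * y * g⁻¹) =
      MonoidAlgebra.single g 1 * matrixCoeff ψ x y * MonoidAlgebra.single g⁻¹ 1 := by
  rw [mem_LambdaC_iff] at hψ
  ext a
  have h : e k a 1 = ofGroup k g * e k (g⁻¹ * a * g) 1 * ofGroup k g⁻¹ := by
    rw [ofGroup_mul_e, e_mul_ofGroup]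
    congr 1 <;> group
  rw [coeff_matrixCoeff, h, map_mul ψ, map_mul ψ, hψ, hψ, coord_conj]
  simp [MonoidAlgebra.coeff_mul_single_apply, MonoidAlgebra.coeff_single_mul_apply,
    coeff_matrixCoeff, mul_assoc]

/-- Equivariance and centrality make the coefficients at `y` and at its conjugates equal. They are
also orthogonal idempotents when the conjugates differ, hence zero. -/
theorem mem_center_of_matrixCoeff_one_ne_zero {ψ : HopfAut k (DrinfeldDouble k G)}
    (hψ : ψ ∈ LambdaC k G) {y : G} (hy : matrixCoeff ψ 1 y ≠ 0) : y ∈ Subgroup.center G := by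
  rw [Subgroup.mem_center_iff]
  intro g
  by_contra hne
  apply hy
  have h1 : matrixCoeff ψ 1 (g * y * g⁻¹) = matrixCoeff ψ 1 y := by
    have := matrixCoeff_conj hψ g 1 y
    rw [mul_one, mul_inv_cancel, ← (commute_matrixCoeff_one ψ y g).eq,
      mul_assoc (matrixCoeff ψ 1 y), MonoidAlgebra.single_mul_single, mul_inv_cancel, mul_one, ← MonoidAlgebra.one_def,
      mul_one] at this
    exact this
  have h2 := matrixCoeff_mul ψ 1 (g * y * g⁻¹) 1 y
  rw [if_neg (by rwa [mul_inv_eq_iff_eq_mul]), h1, matrixCoeff_mul, if_pos rfl, mul_one] at h2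
  exact h2

/-! ### The component `k^G → k^G` of an element of `Λ_c(G)` -/

/-- The coefficients of `e_x` in the elements `(id ⊗ ε) ψ(e_g # 1)`, as an element of `kG`. -/
noncomputable def rowSum (ψ : HopfAut k (DrinfeldDouble k G)) (x : G) : MonoidAlgebra k G :=
  ∑ y : G, matrixCoeff ψ x y

theorem rowSum_one (ψ : HopfAut k (DrinfeldDouble k G)) : rowSum ψ 1 = 1 :=
  sum_matrixCoeff_one ψ

theorem rowSum_mul (ψ : HopfAut k (DrinfeldDouble k G)) (x x' : G) :
    rowSum ψ x * rowSum ψ x' = rowSum ψ (x * x') := by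
  simp [rowSum, Finset.sum_mul, Finset.mul_sum, matrixCoeff_mul]

theorem rowSum_mul_matrixCoeff_one (ψ : HopfAut k (DrinfeldDouble k G)) (x y : G) :
    rowSum ψ x * matrixCoeff ψ 1 y = matrixCoeff ψ x y := by
  simp [rowSum, Finset.sum_mul, matrixCoeff_mul]

theorem rowSum_conj {ψ : HopfAut k (DrinfeldDouble k G)} (hψ : ψ ∈ LambdaC k G) (g x : G) :
    rowSum ψ (g * x * g⁻¹) =
      MonoidAlgebra.single g 1 * rowSum ψ x * MonoidAlgebra.single g⁻¹ 1 := by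
  rw [rowSum, rowSum, Finset.mul_sum, Finset.sum_mul]
  refine (Fintype.sum_equiv (MulAut.conj g).toEquiv _ _ fun y => ?_).symm
  exact (matrixCoeff_conj hψ g x y).symm

theorem coeff_rowSum (ψ : HopfAut k (DrinfeldDouble k G)) (x g : G) :
    (rowSum ψ x).coeff g = ∑ y : G, coord x y (ψ (e k g 1)) := by
  rw [rowSum, MonoidAlgebra.coeff_sum, Finsupp.finsetSum_apply]
  simp only [coeff_matrixCoeff]

/-- The map `id ⊗ ε` is not multiplicative on `D(G)`. It becomes so when the left factor is
supported on `k^G ⊗ kZ(G)`, because central elements do not twist `k^G`. -/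
theorem sum_coord_mul {w : DrinfeldDouble k G}
    (hw : ∀ x y, coord x y w ≠ 0 → y ∈ Subgroup.center G) (w' : DrinfeldDouble k G) (x : G) :
    ∑ y : G, coord x y (w * w') = (∑ y : G, coord x y w) * ∑ y : G, coord x y w' := by
  have key : ∀ a b : G, b ∈ Subgroup.center G → ∀ w' : DrinfeldDouble k G,
      ∑ y : G, coord x y (e k a b * w') =
        (∑ y : G, coord x y (e k a b)) * ∑ y : G, coord x y w' := by
    intro a b hb w'
    induction w' using induction_e with
    | h0 => simp
    | hadd x x' hx hx' => simp only [mul_add, map_add, Finset.sum_add_distrib, hx, hx']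
    | hsmul c x hx =>
      simp only [mul_smul_comm, map_smul, ← Finset.smul_sum, hx]
    | he c d =>
      have h1 : b * c * b⁻¹ = c := by
        rw [← Subgroup.mem_center_iff.1 hb c, mul_inv_cancel_right]
      rw [e_mul_e, h1]
      by_cases hac : a = c
      · subst hac
        by_cases hax : a = x <;> simp [coord_e, hax]
      · by_cases hax : a = x
        · have hcx : ¬ c = x := fun h => hac (hax.trans h.symm)
          simp [coord_e, hac, hcx]
        · simp [coord_e, hac, hax]
  have hlin : ∀ u : DrinfeldDouble k G, ∑ y : G, coord x y u = (∑ y : G, coord x y) u := by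
    intro u; rw [LinearMap.sum_apply]
  conv_lhs => rw [← sum_coord_smul_e w]
  conv_rhs => rw [← sum_coord_smul_e w]
  rw [hlin, hlin (∑ x : G, ∑ y : G, coord x y w • e k x y)]
  simp only [Finset.sum_mul, map_sum, smul_mul_assoc, map_smul]
  refine Finset.sum_congr rfl fun a _ => Finset.sum_congr rfl fun b _ => ?_
  by_cases h0 : coord a b w = 0
  · simp [h0]
  · rw [← hlin, ← hlin, key a b (hw a b h0)]

/-- The `e_g` are orthogonal idempotents, and `id ⊗ ε` is multiplicative on their images, which have
central second components. So the coefficients are orthogonal idempotent scalars: at most one is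
nonzero, and it is `1`. -/
theorem coeff_rowSum_mul {ψ : HopfAut k (DrinfeldDouble k G)} (hψ : ψ ∈ LambdaC k G)
    (x g g' : G) : (rowSum ψ x).coeff g * (rowSum ψ x).coeff g' =
      if g = g' then (rowSum ψ x).coeff g else 0 := by
  rw [coeff_rowSum, coeff_rowSum, ← sum_coord_mul, ← map_mul, e_one_mul_e_one]
  · split_ifs <;> simp
  · intro a y hay
    refine mem_center_of_matrixCoeff_one_ne_zero hψ fun h0 => hay ?_
    rw [← coeff_matrixCoeff, ← rowSum_mul_matrixCoeff_one, h0, mul_zero]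
    rfl

theorem exists_rowSum_eq_single {ψ : HopfAut k (DrinfeldDouble k G)} (hψ : ψ ∈ LambdaC k G)
    (x : G) : ∃ u : G, rowSum ψ x = MonoidAlgebra.single u 1 := by
  have hne : rowSum ψ x ≠ 0 := by
    intro h0
    have h1 := rowSum_mul ψ x x⁻¹
    rw [h0, zero_mul, mul_inv_cancel, rowSum_one] at h1
    exact zero_ne_one h1
  obtain ⟨u, hu⟩ : ∃ u, (rowSum ψ x).coeff u ≠ 0 := by
    by_contra! h
    exact hne (by ext g; simpa using h g)
  refine ⟨u, ?_⟩
  have h1 : (rowSum ψ x).coeff u = 1 := by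
    have := coeff_rowSum_mul hψ x u u
    rw [if_pos rfl] at this
    exact mul_left_cancel₀ hu (this.trans (mul_one _).symm)
  ext g
  rw [MonoidAlgebra.coeff_single, Finsupp.single_apply]
  split_ifs with h
  · rw [← h, h1]
  · have := coeff_rowSum_mul hψ x u g
    rwa [if_neg h, h1, one_mul] at this

theorem single_one_injective {R M : Type*} [Semiring R] [Nontrivial R] [Monoid M] {g h : M}
    (H : (MonoidAlgebra.single g 1 : MonoidAlgebra R M) = MonoidAlgebra.single h 1) : g = h :=
  MonoidAlgebra.of_injective (R := R) (M := M) H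

/-- For an element `(p, u, 1, id)` of `Λ_c(G)`, the component `u` is dual to an endomorphism of
`G` that is trivial modulo the centre. -/
theorem exists_rowSum_eq_single_mul {ψ : HopfAut k (DrinfeldDouble k G)}
    (hψ : ψ ∈ LambdaC k G) (x : G) :
    ∃ z ∈ Subgroup.center G, rowSum ψ x = MonoidAlgebra.single (x * z) 1 := by
  choose u hu using exists_rowSum_eq_single hψ
  -- Conjugating `u(y)` by `x` (equivariance) or by `u(x)` (multiplicativity) gives `u(x y x⁻¹)` in
  -- both cases.
  have hcomm : ∀ y, Commute (x⁻¹ * u x) (u y) := by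
    intro y
    have h1 := rowSum_conj hψ x y
    have h2 : rowSum ψ (x * y * x⁻¹) * rowSum ψ x = rowSum ψ x * rowSum ψ y := by
      rw [rowSum_mul, rowSum_mul, inv_mul_cancel_right]
    rw [h1] at h2
    simp only [hu, MonoidAlgebra.single_mul_single, mul_one] at h2
    have h3 := single_one_injective h2
    rw [Commute, SemiconjBy, mul_assoc, ← h3]
    group
  refine ⟨x⁻¹ * u x, ?_, by rw [mul_inv_cancel_left, hu]⟩
  rw [Subgroup.mem_center_iff]
  intro g
  have h := commute_of_commute_matrixCoeff ψ
    (c := MonoidAlgebra.single (x⁻¹ * u x) 1) (fun a y => ?_) g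
  · have h1 := h.eq
    rw [MonoidAlgebra.single_mul_single, MonoidAlgebra.single_mul_single, mul_one] at h1
    exact (single_one_injective h1).symm
  -- Each matrix coefficient is `u(a)` times a central element, so commuting with all `u(a)`
  -- suffices.
  · rw [← rowSum_mul_matrixCoeff_one]
    refine Commute.mul_right ?_ (commute_matrixCoeff_one ψ y _).symm
    rw [hu, Commute, SemiconjBy, MonoidAlgebra.single_mul_single,
      MonoidAlgebra.single_mul_single, (hcomm a).eq]

theorem sum_coord_map_charTensor (ψ : HopfAut k (DrinfeldDouble k G)) (χ : G →* kˣ) (x : G) :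
    ∑ y : G, coord x y (ψ (charTensor χ 1)) = ∑ g : G, (χ g : k) * (rowSum ψ x).coeff g := by
  simp only [charTensor, map_sum, map_smul, coeff_rowSum, Finset.mul_sum, smul_eq_mul]
  rw [Finset.sum_comm]

theorem map_charTensor_of_mem_LambdaC (hG : IsStemGroup G)
    {ψ : HopfAut k (DrinfeldDouble k G)} (hψ : ψ ∈ LambdaC k G) (χ : G →* kˣ) (h : G) :
    ψ (charTensor χ h) = charTensor χ h := by
  have key : ψ (charTensor χ 1) = charTensor χ 1 := by
    obtain ⟨χ', hχ⟩ := exists_map_charTensor_one hG ψ χ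
    rw [hχ]
    congr 1
    ext x
    obtain ⟨z, hz, hx⟩ := exists_rowSum_eq_single_mul hψ x
    have h1 := sum_coord_map_charTensor ψ χ x
    -- The character of `ψ(χ # 1)` takes the value `χ(x z)` at `x`; it equals `χ(x)` since `z ∈ Z(G)
    -- ≤ G'`.
    have h2 : χ z = 1 := Abelianization.commutator_subset_ker χ (hG hz)
    simpa [hχ, coord_charTensor, hx, Finsupp.single_apply, h2] using h1
  have hsplit : charTensor χ h = charTensor χ 1 * ofGroup k h := by
    rw [← charTensor_one, charTensor_mul, one_mul]
    exact congrArg (fun χ => charTensor χ h) (mul_one χ).symm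
  rw [hsplit, map_mul, key, (mem_LambdaC_iff ψ).1 hψ]

/-- `φ⁻¹` sends `1 # g` to a group-like, which `ψ` fixes, and `φ` sends it back. -/
theorem normal_LambdaC (hG : IsStemGroup G) : (LambdaC k G).Normal where
  conj_mem ψ hψ φ := by
    rw [mem_LambdaC_iff]
    intro g
    obtain ⟨χ, h, hχ⟩ := exists_map_charTensor φ⁻¹ 1 g
    rw [← charTensor_one, HopfAut.mul_apply, HopfAut.mul_apply, hχ,
      map_charTensor_of_mem_LambdaC hG hψ, ← hχ]
    exact φ.apply_symm_apply _

/-! ### The semidirect product decomposition -/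

theorem exists_mulEquiv_of_isStemGroup (hG : IsStemGroup G) :
    ∃ (φ : BChAut k G →* MulAut (LambdaC k G))
      (f : LambdaC k G ⋊[φ] BChAut k G ≃* HopfAut k (DrinfeldDouble k G)),
      (∀ x : LambdaC k G, f (SemidirectProduct.inl x) = (x : HopfAut k (DrinfeldDouble k G))) ∧
      (∀ y : BChAut k G, f (SemidirectProduct.inr y) = bchAutEmb k G y) := by
  have := normal_LambdaC (k := k) hG
  let φ : BChAut k G →* MulAut (LambdaC k G) := MulAut.conjNormal.comp (bchAutEmb k G)
  let F : LambdaC k G ⋊[φ] BChAut k G →* HopfAut k (DrinfeldDouble k G) :=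
    SemidirectProduct.lift (LambdaC k G).subtype (bchAutEmb k G) (by
      intro y
      ext x : 1
      exact MulAut.conjNormal_apply _ _)
  have hF : ∀ a, F a = a.left * bchAutEmb k G a.right := fun a => rfl
  refine ⟨φ, MulEquiv.ofBijective F ⟨?_, fun ψ => ?_⟩, fun x => ?_, fun y => ?_⟩
  · refine (injective_iff_map_eq_one F).2 fun a ha => ?_
    rw [hF] at ha
    have h1 : a.right = 1 := by
      refine bchAutEmb_mem_LambdaC ?_
      rw [← inv_eq_of_mul_eq_one_right ha]
      exact (LambdaC k G).inv_mem a.left.2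
    rw [h1, map_one, mul_one] at ha
    exact SemidirectProduct.ext (Subtype.ext ha) h1
  -- The factorization has its `Λ_c(G)` factor on the right; conjugation moves it to the left.
  · obtain ⟨x, hx⟩ := exists_bchAutEmb_mul_mem_LambdaC hG ψ
    refine ⟨⟨⟨_, this.conj_mem _ hx (bchAutEmb k G x)⟩, x⟩, ?_⟩
    rw [hF]
    simp [mul_assoc]
  · change F _ = _
    simp [hF]
  · change F _ = _
    simp [hF]

/-- The left factor is the kernel of the projection to `H`, and `f` carries it onto `L`. -/
theorem normal_of_mulEquiv_semidirectProduct {A H : Type*} [Group A] [Group H]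
    {L : Subgroup A} {φ : H →* MulAut L} (f : L ⋊[φ] H ≃* A)
    (hf : ∀ x : L, f (SemidirectProduct.inl x) = x) : L.Normal where
  conj_mem n hn g := by
    obtain ⟨a, rfl⟩ := f.surjective g
    have h1 : f (a * SemidirectProduct.inl ⟨n, hn⟩ * a⁻¹) = f a * n * (f a)⁻¹ := by
      rw [map_mul, map_mul, hf, map_inv]
    have h2 : a * SemidirectProduct.inl ⟨n, hn⟩ * a⁻¹ ∈
        (SemidirectProduct.rightHom : L ⋊[φ] H →* H).ker := by
      simp [MonoidHom.mem_ker]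
    rw [← SemidirectProduct.range_inl_eq_ker_rightHom] at h2
    obtain ⟨m, hm⟩ := h2
    rw [← h1, ← hm, hf]
    exact m.2

/-! ### Groups that are not stem groups

For a cyclic central subgroup `t : ℤ/n → Z(G)` and a primitive additive character `ψ` of `ℤ/n`,
the bicharacter `(i, j) ↦ ψ (i j)` gives an element of `Λ_c(G)` of the form `(p, 1, 1, id)`. -/

theorem sum_mul_eq_ite {n : ℕ} [NeZero n] {ψ : AddChar (ZMod n) k} (hψ : ψ.IsPrimitive)
    (i : ZMod n) : ∑ j : ZMod n, ψ (i * j) = if i = 0 then (n : k) else 0 := by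
  have h := AddChar.sum_mulShift i hψ
  simp only [mul_comm _ i, ZMod.card] at h
  rw [h]
  split_ifs <;> simp

theorem coe_mul_comm {M : Type*} [Group M] (c : Subgroup.center M) (g : M) : (c : M) * g = g * c :=
  (Subgroup.mem_center_iff.1 c.2 g).symm

/-- The linear map `e_g # h ↦ (1/n) ∑ ψ(i j) e_{g t(i)} # t(j) h`. -/
noncomputable def twist {n : ℕ} [NeZero n] (ψ : AddChar (ZMod n) k)
    (t : AddChar (ZMod n) (Subgroup.center G)) : DrinfeldDouble k G →ₗ[k] DrinfeldDouble k G :=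
  lift fun g h => (n : k)⁻¹ • ∑ i : ZMod n, ∑ j : ZMod n, ψ (i * j) • e k (g * t i) (t j * h)

variable {n : ℕ} [NeZero n] {ψ : AddChar (ZMod n) k} {t : AddChar (ZMod n) (Subgroup.center G)}

theorem twist_e (g h : G) : twist ψ t (e k g h) =
    (n : k)⁻¹ • ∑ i : ZMod n, ∑ j : ZMod n, ψ (i * j) • e k (g * t i) (t j * h) := lift_e _ _ _

theorem twist_charTensor (χ : G →* kˣ) (h : G) : twist ψ t (charTensor χ h) =
    (n : k)⁻¹ • ∑ i : ZMod n, ∑ j : ZMod n,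
      (ψ (i * j) * ((χ (t i))⁻¹ : kˣ)) • charTensor χ (t j * h) := by
  simp only [charTensor, map_sum, map_smul, twist_e, smul_comm _ (n : k)⁻¹, ← Finset.smul_sum]
  congr 1
  simp only [Finset.smul_sum, smul_smul]
  rw [Finset.sum_comm]
  refine Finset.sum_congr rfl fun i _ => ?_
  rw [Finset.sum_comm]
  refine Finset.sum_congr rfl fun j _ => ?_
  refine Fintype.sum_equiv (Equiv.mulRight (t i : G)) _ _ fun g => ?_
  have h1 : ((χ (t i))⁻¹ : kˣ) * (χ (g * t i) : k) = χ g := by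
    rw [← Units.val_mul, map_mul, mul_comm, mul_inv_cancel_right]
  rw [Equiv.coe_mulRight, mul_assoc, h1, mul_comm]

theorem twist_inv_twist (hn : (n : k) ≠ 0) (hψ : ψ.IsPrimitive) (g h : G) :
    twist ψ⁻¹ t (twist ψ t (e k g h)) = e k g h := by
  have h1 : ∀ i j : ZMod n, twist ψ⁻¹ t (e k (g * t i) (t j * h)) =
      (n : k)⁻¹ • ∑ a : ZMod n, ∑ b : ZMod n,
        ψ (-((a - i) * (b - j))) • e k (g * t a) (t b * h) := by
    intro i j
    rw [twist_e]
    congr 1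
    refine Fintype.sum_equiv (Equiv.addLeft i) _ _ fun a => ?_
    refine Fintype.sum_equiv (Equiv.addLeft j) _ _ fun b => ?_
    rw [AddChar.inv_apply]
    have h2 : g * (t i : G) * t a = g * t (i + a) := by
      rw [AddChar.map_add_eq_mul, Subgroup.coe_mul, mul_assoc]
    have h3 : (t b : G) * (t j * h) = t (j + b) * h := by
      rw [AddChar.map_add_eq_mul, Subgroup.coe_mul, ← mul_assoc, coe_mul_comm (t b)]
    rw [h2, h3]
    simp
  -- Fourier inversion: `ij - (a-i)(b-j) = -ab + bi + aj`, so the double sum factors into two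
  -- complete character sums.
  have h2 : ∀ a b : ZMod n, ∑ i : ZMod n, ∑ j : ZMod n, ψ (i * j) * ψ (-((a - i) * (b - j))) =
      if a = 0 then if b = 0 then (n : k) * n else 0 else 0 := by
    intro a b
    have h3 : ∀ i j : ZMod n, ψ (i * j) * ψ (-((a - i) * (b - j))) =
        ψ (-(a * b)) * (ψ (b * i) * ψ (a * j)) := by
      intro i j
      simp only [← AddChar.map_add_eq_mul]
      congr 1
      ring
    simp only [h3, ← Finset.mul_sum, ← Finset.sum_mul, sum_mul_eq_ite hψ]
    split_ifs with ha hb <;> simp [*]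
  have h4 : twist ψ⁻¹ t (twist ψ t (e k g h)) = (n : k)⁻¹ • (n : k)⁻¹ •
      ∑ a : ZMod n, ∑ b : ZMod n, (∑ i : ZMod n, ∑ j : ZMod n,
        ψ (i * j) * ψ (-((a - i) * (b - j)))) • e k (g * t a) (t b * h) := by
    rw [twist_e]
    simp only [map_smul, map_sum, h1, Finset.smul_sum, smul_smul, Finset.sum_smul]
    simp only [← Fintype.sum_prod_type']
    exact Fintype.sum_equiv
      ⟨fun x => (x.2.2.1, x.2.2.2, x.1, x.2.1), fun x => (x.2.2.1, x.2.2.2, x.1, x.2.1),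
        fun _ => rfl, fun _ => rfl⟩ _ _ fun ⟨i, j, a, b⟩ => by
          dsimp only [Equiv.coe_fn_mk]
          congr 1
          ring
  rw [h4]
  simp [h2, smul_smul, hn]

theorem twist_mul (hn : (n : k) ≠ 0) (hψ : ψ.IsPrimitive) (g h g' h' : G) :
    twist ψ t (e k g h * e k g' h') = twist ψ t (e k g h) * twist ψ t (e k g' h') := by
  have hterm : ∀ i j i' j' : ZMod n,
      e k (g * t i) (t j * h) * e k (g' * t i') (t j' * h') =
        if g = h * g' * h⁻¹ * t (i' - i) then e k (g * t i) (t (j + j') * (h * h')) else 0 := by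
    intro i j i' j'
    have h1 : g * (t i : G) = t j * h * (g' * t i') * (t j * h)⁻¹ ↔
        g = h * g' * h⁻¹ * t (i' - i) := by
      have h2 : (t j : G) * h * (g' * t i') * (t j * h)⁻¹ = h * g' * h⁻¹ * t i' := by
        have h3 : (t j : G) * h * (g' * t i') * (t j * h)⁻¹ =
          t j * (h * g' * (t i' * h⁻¹)) * (t j : G)⁻¹ := by group
        rw [h3, coe_mul_comm, mul_inv_cancel_right, coe_mul_comm, mul_assoc]
        group
      rw [h2, sub_eq_add_neg, AddChar.map_add_eq_mul, AddChar.map_neg_eq_inv, Subgroup.coe_mul,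
        Subgroup.coe_inv, ← mul_assoc, eq_mul_inv_iff_mul_eq]
    have h4 : (t j : G) * h * (t j' * h') = t (j + j') * (h * h') := by
      rw [AddChar.map_add_eq_mul, Subgroup.coe_mul, mul_assoc, ← mul_assoc h,
        ← coe_mul_comm (t j') h]
      group
    rw [e_mul_e, h4]
    simp only [h1]
  have hi : ∀ i : ZMod n, ∑ j : ZMod n, ∑ i' : ZMod n, ∑ j' : ZMod n,
      (ψ (i * j) * ψ (i' * j')) •
        (e k (g * t i) (t j * h) * e k (g' * t i') (t j' * h')) =
      (n : k) • ∑ j : ZMod n, ψ (i * j) •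
        if g = h * g' * h⁻¹ then e k (g * t i) (t j * (h * h')) else 0 := by
    intro i
    -- With `b = j + j'` fixed, the sum over `j'` forces `i' = i`, so the shift `t (i' - i)` in the
    -- support condition disappears.
    have h5 : ∀ b i' : ZMod n, ∑ j' : ZMod n, ψ (i * (b - j')) * ψ (i' * j') =
        if i' = i then ψ (i * b) * n else 0 := by
      intro b i'
      have h6 : ∀ j', ψ (i * (b - j')) * ψ (i' * j') = ψ (i * b) * ψ ((i' - i) * j') := by
        intro j'
        simp only [← AddChar.map_add_eq_mul]
        congr 1
        ring
      simp only [h6, ← Finset.mul_sum, sum_mul_eq_ite hψ, sub_eq_zero]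
      split_ifs <;> simp
    trans ∑ b : ZMod n, ∑ i' : ZMod n, (∑ j' : ZMod n, ψ (i * (b - j')) * ψ (i' * j')) •
      if g = h * g' * h⁻¹ * t (i' - i) then e k (g * t i) (t b * (h * h')) else 0
    · simp only [Finset.sum_smul, hterm]
      simp only [← Fintype.sum_prod_type']
      exact Fintype.sum_equiv
        ⟨fun x => (x.1 + x.2.2, x.2.1, x.2.2), fun x => (x.1 - x.2.2, x.2.1, x.2.2),
          fun _ => by simp, fun _ => by simp⟩ _ _ fun _ => by simp
    · rw [Finset.smul_sum]
      refine Finset.sum_congr rfl fun b _ => ?_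
      simp only [h5, ite_smul, zero_smul, Finset.sum_ite_eq', Finset.mem_univ, if_true,
        sub_self, AddChar.map_zero_eq_one, Subgroup.coe_one, mul_one]
      rw [smul_smul, mul_comm]
  rw [twist_e, twist_e, smul_mul_smul_comm]
  simp only [Finset.sum_mul]
  simp only [Finset.mul_sum, smul_mul_smul_comm, hi]
  rw [e_mul_e, ← Finset.smul_sum, smul_smul, mul_assoc (n : k)⁻¹, inv_mul_cancel₀ hn, mul_one]
  split_ifs
  · rw [twist_e]
  · simp

theorem counit_twist (hn : (n : k) ≠ 0) (hψ : ψ.IsPrimitive) (g h : G) :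
    Coalgebra.counit (R := k) (twist ψ t (e k g h)) = Coalgebra.counit (R := k) (e k g h) := by
  simp only [twist_e, map_smul, map_sum, counit_e, smul_eq_mul, ← Finset.sum_mul,
    sum_mul_eq_ite hψ]
  rw [Finset.sum_eq_single 0]
  · simp [hn]
  · intro i _ hi
    simp [hi]
  · simp

theorem comul_twist (hn : (n : k) ≠ 0) (hψ : ψ.IsPrimitive) (g h : G) :
    TensorProduct.map (twist ψ t) (twist ψ t) (Coalgebra.comul (R := k) (e k g h)) =
      Coalgebra.comul (R := k) (twist ψ t (e k g h)) := by
  -- Dually to multiplicativity, with `b = i + i'` fixed the sum over `i'` forces `j' = j`, as a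
  -- coproduct needs the same group element in both legs.
  have hsum : ∀ b j j' : ZMod n, ∑ i' : ZMod n, ψ ((b - i') * j) * ψ (i' * j') =
      if j' = j then ψ (b * j) * n else 0 := by
    intro b j j'
    have h6 : ∀ i', ψ ((b - i') * j) * ψ (i' * j') = ψ (b * j) * ψ ((j' - j) * i') := by
      intro i'
      simp only [← AddChar.map_add_eq_mul]
      congr 1
      ring
    simp only [h6, ← Finset.mul_sum, sum_mul_eq_ite hψ, sub_eq_zero]
    split_ifs <;> simp
  simp only [comul_e, map_sum, TensorProduct.map_tmul, twist_e, map_smul,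
    TensorProduct.smul_tmul_smul, ← Finset.smul_sum, TensorProduct.sum_tmul,
    TensorProduct.tmul_sum]
  trans ((n : k)⁻¹ * (n : k)⁻¹) • ∑ b : ZMod n, ∑ j : ZMod n, ∑ j' : ZMod n,
    (∑ i' : ZMod n, ψ ((b - i') * j) * ψ (i' * j')) •
      ∑ a : G, e k (a⁻¹ * (g * t b)) (t j * h) ⊗ₜ[k] e k a (t j' * h)
  · congr 1
    simp only [Finset.sum_smul, Finset.smul_sum]
    simp only [← Fintype.sum_prod_type']
    let E : G × ZMod n × ZMod n × ZMod n × ZMod n ≃ ZMod n × ZMod n × ZMod n × G × ZMod n :=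
      ⟨fun (a, i', j', i, j) => (i + i', j, j', a * (t i' : G), i'),
        fun (b, j, j', a, i') => (a * (t i' : G)⁻¹, i', j', b - i', j),
        fun _ => by simp, fun _ => by simp⟩
    refine Fintype.sum_equiv E _ _ fun x => ?_
    obtain ⟨a, i', j', i, j⟩ := x
    have h1 : (a * (t i' : G))⁻¹ * (g * t (i + i')) = a⁻¹ * g * t i := by
      rw [AddChar.map_add_eq_mul, Subgroup.coe_mul, ← mul_assoc g,
        ← coe_mul_comm (t i') (g * t i), ← coe_mul_comm (t i') a]
      group
    rw [mul_inv_rev] at h1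
    simp [E, h1]
  · simp only [hsum, ite_smul, zero_smul, Finset.sum_ite_eq', Finset.mem_univ, if_true,
      mul_comm _ (n : k), ← smul_smul, ← Finset.smul_sum]
    rw [smul_smul (n : k)⁻¹ (n : k), inv_mul_cancel₀ hn, one_smul]

/-- The automorphism `e_g # h ↦ (1/n) ∑ ψ(i j) e_{g t(i)} # t(j) h`. -/
noncomputable def twistAut (hn : (n : k) ≠ 0) (hψ : ψ.IsPrimitive)
    (t : AddChar (ZMod n) (Subgroup.center G)) : HopfAut k (DrinfeldDouble k G) :=
  mkAut (twist ψ t) (twist ψ⁻¹ t) (twist_inv_twist hn hψ)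
    (fun g h => by
      have hψ' : ψ⁻¹.IsPrimitive := fun a ha h0 => hψ ha (by
        ext x
        have := DFunLike.congr_fun h0 (-x)
        simpa [AddChar.mulShift_apply] using this)
      have := twist_inv_twist (t := t) hn hψ' g h
      rwa [inv_inv] at this)
    (twist_mul hn hψ) (counit_twist hn hψ) (comul_twist hn hψ)

theorem twistAut_apply (hn : (n : k) ≠ 0) (hψ : ψ.IsPrimitive)
    (t : AddChar (ZMod n) (Subgroup.center G)) (w : DrinfeldDouble k G) :
    twistAut hn hψ t w = twist ψ t w := rfl

theorem twistAut_mem_LambdaC (hn : (n : k) ≠ 0) (hψ : ψ.IsPrimitive)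
    (t : AddChar (ZMod n) (Subgroup.center G)) : twistAut hn hψ t ∈ LambdaC k G := by
  rw [mem_LambdaC_iff]
  intro h
  rw [twistAut_apply, ← charTensor_one, twist_charTensor, Finset.sum_comm]
  have hs : ∀ j, ∑ i, ψ (i * j) = if j = 0 then (n : k) else 0 := fun j => by
    simp only [mul_comm _ j, sum_mul_eq_ite hψ]
  simp only [MonoidHom.one_apply, inv_one, Units.val_one, mul_one, ← Finset.sum_smul, hs]
  simp [smul_smul, hn]

/-! ### Linear characters and bicharacters -/

/-- The image of `χ` is a finite subgroup of `Fˣ`, hence cyclic, generated by some `ζ = χ(h)`. Since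
`χ` has order dividing that of `ζ`, there is a homomorphism `ζ ↦ χ` on the image; composing it with
`χ` gives `r`. -/
theorem exists_bicharacter_apply_eq {F : Type*} [Field F] {H : Type*} [Group H] [Finite H]
    (χ : H →* Fˣ) : ∃ (r : H →* (H →* Fˣ)) (h : H), r h = χ := by
  have : Finite χ.range := Set.finite_range χ
  obtain ⟨⟨ζ, h, hh⟩, hζ⟩ := IsCyclic.exists_generator (α := χ.range)
  have hord : orderOf χ ∣ orderOf (⟨ζ, h, hh⟩ : χ.range) := by
    rw [orderOf_dvd_iff_pow_eq_one]
    ext g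
    obtain ⟨m, hm⟩ := Subgroup.mem_zpowers_iff.1 (hζ ⟨χ g, g, rfl⟩)
    have h1 : χ.rangeRestrict g ^ orderOf (⟨ζ, h, hh⟩ : χ.range) = 1 := by
      change (⟨χ g, g, rfl⟩ : χ.range) ^ _ = 1
      rw [← hm, ← zpow_natCast, ← zpow_mul, mul_comm, zpow_mul, zpow_natCast,
        pow_orderOf_eq_one, one_zpow]
    have h2 := congrArg (fun u : χ.range => ((u : Fˣ) : F)) h1
    simpa using h2
  refine ⟨(monoidHomOfForallMemZpowers hζ hord).comp χ.rangeRestrict, h, ?_⟩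
  have h3 : χ.rangeRestrict h = ⟨ζ, h, hh⟩ := Subtype.ext hh
  rw [MonoidHom.comp_apply, h3, monoidHomOfForallMemZpowers_apply_gen]

theorem exists_character_apply_ne_one (F : Type*) [Field F] [IsAlgClosed F] [CharZero F]
    {H : Type*} [Group H] [Finite H] {g : H} (hg : g ∉ commutator H) :
    ∃ χ : H →* Fˣ, χ g ≠ 1 := by
  have h1 : Abelianization.of g ≠ 1 := by
    rwa [Ne, ← MonoidHom.mem_ker, Abelianization.ker_of]
  have : NeZero ((Monoid.exponent (Abelianization H) : ℕ) : F) :=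
    ⟨Nat.cast_ne_zero.2 Monoid.exponent_ne_zero_of_finite⟩
  obtain ⟨χ, hχ⟩ := CommGroup.exists_apply_ne_one_of_hasEnoughRootsOfUnity (Abelianization H) F h1
  exact ⟨χ.comp Abelianization.of, hχ⟩

/-! ### Normality forces the stem condition -/

theorem isStemGroup_of_normal_LambdaC [IsAlgClosed k] [CharZero k]
    (hN : (LambdaC k G).Normal) : IsStemGroup G := by
  intro z hz
  by_contra hz'
  obtain ⟨χ, hχ⟩ := exists_character_apply_ne_one k hz'
  obtain ⟨r, h, rfl⟩ := exists_bicharacter_apply_eq χ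
  let c : Subgroup.center G := ⟨z, hz⟩
  let n := orderOf c
  have : NeZero n := ⟨(orderOf_pos c).ne'⟩
  have hn : (n : k) ≠ 0 := Nat.cast_ne_zero.2 (NeZero.ne n)
  have : NeZero (n : k) := ⟨hn⟩
  obtain ⟨ζ, hζ⟩ := HasEnoughRootsOfUnity.exists_primitiveRoot k n
  have hψ := AddChar.zmodChar_primitive_of_primitive_root n hζ
  let t : AddChar (ZMod n) (Subgroup.center G) :=
    { toFun := fun a => c ^ a.val
      map_zero_eq_one' := by rw [ZMod.val_zero, pow_zero]
      map_add_eq_mul' := fun a b => by rw [ZMod.val_add, pow_mod_orderOf, pow_add] }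
  have ht : ∀ j, (t j : G) = 1 → j = 0 := by
    intro j hj
    have h1 : c ^ j.val = 1 := Subtype.ext hj
    rw [← orderOf_dvd_iff_pow_eq_one] at h1
    exact (ZMod.val_eq_zero j).1 (Nat.eq_zero_of_dvd_of_lt h1 (ZMod.val_lt j))
  set Λ := twistAut hn hψ t
  have hmem := hN.conj_mem Λ (twistAut_mem_LambdaC hn hψ t) (bchEmb k G r)⁻¹
  rw [inv_inv, mem_LambdaC_iff] at hmem
  have hβ : bchEmb k G r (ofGroup k h) = charTensor (r h) h := by
    simp [ofGroup, charTensor, map_sum, bchEmb_apply_e]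
  have h1 : Λ (charTensor (r h) h) = charTensor (r h) h := by
    rw [← hβ]
    have h2 := congrArg (bchEmb k G r) (hmem h)
    rw [HopfAut.mul_apply, HopfAut.mul_apply] at h2
    exact ((bchEmb k G r).apply_symm_apply _).symm.trans h2
  -- In the coordinate of `e_1 # h` only `j = 0` survives on the left, leaving `(1/n) ∑ χ(z^i)⁻¹`;
  -- on the right it is `1`. The sum vanishes, being over a nontrivial character of `ℤ/n`.
  have h2 := congrArg (coord 1 h) h1
  rw [twistAut_apply, twist_charTensor, coord_charTensor, if_pos rfl] at h2
  simp only [map_smul, map_sum, coord_charTensor, mul_eq_right, map_one, Units.val_one] at h2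
  have h3 : ∀ j, (t j : G) = 1 ↔ j = 0 := fun j => ⟨ht j, fun hj => by simp [hj]⟩
  simp only [h3, smul_eq_mul, mul_ite, mul_one, mul_zero, Finset.sum_ite_eq', Finset.mem_univ,
    if_true, AddChar.map_zero_eq_one, one_mul] at h2
  let η : AddChar (ZMod n) k :=
    ((Units.coeHom k).comp ((r h)⁻¹.comp (Subgroup.center G).subtype)).compAddChar t
  have hη : η ≠ 1 := by
    intro h0
    apply hχ
    -- Casting `1` from `ℕ` makes its representative `1 % n`, which avoids treating `n = 1`
    -- separately.
    have h4 : (((r h (t (1 : ℕ)))⁻¹ : kˣ) : k) = 1 := DFunLike.congr_fun h0 ((1 : ℕ) : ZMod n)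
    have h5 : t (1 : ℕ) = c := by
      change c ^ ZMod.val ((1 : ℕ) : ZMod n) = c
      rw [ZMod.val_natCast, pow_mod_orderOf, pow_one]
    rwa [h5, Units.val_eq_one, inv_eq_one] at h4
  have h5 : ∑ i, η i = 0 := AddChar.sum_eq_zero_of_ne_one hη
  have h6 : ∑ i, (((r h (t i))⁻¹ : kˣ) : k) = 0 := h5
  rw [h6, mul_zero] at h2
  exact zero_ne_one h2

end DrinfeldDouble

theorem mainTheorem10 {k : Type*} [Field k] [IsAlgClosed k] [CharZero k]
    {G : Type*} [Group G] [Fintype G] [DecidableEq G] :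
    ((DrinfeldDouble.LambdaC k G).Normal ↔ IsStemGroup G) ∧
    ((∃ (φ : DrinfeldDouble.BChAut k G →* MulAut (DrinfeldDouble.LambdaC k G))
        (f : DrinfeldDouble.LambdaC k G ⋊[φ] DrinfeldDouble.BChAut k G ≃*
          HopfAut k (DrinfeldDouble k G)),
        (∀ x : DrinfeldDouble.LambdaC k G,
          f (SemidirectProduct.inl x) = (x : HopfAut k (DrinfeldDouble k G))) ∧
        (∀ y : DrinfeldDouble.BChAut k G,
          f (SemidirectProduct.inr y) = DrinfeldDouble.bchAutEmb k G y)) ↔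
      IsStemGroup G) := by
  refine ⟨⟨DrinfeldDouble.isStemGroup_of_normal_LambdaC, DrinfeldDouble.normal_LambdaC⟩,
    ?_, DrinfeldDouble.exists_mulEquiv_of_isStemGroup⟩
  rintro ⟨φ, f, hf, -⟩
  exact DrinfeldDouble.isStemGroup_of_normal_LambdaC
    (DrinfeldDouble.normal_of_mulEquiv_semidirectProduct f hf)
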